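/- A ReLU network $f:\mathbb R^d\to\mathbb R$ consists of hidden layers $a\mapsto\sigma(Wa+b)$ of positive widths, with $\sigma(t)=\max\{t,0\}$ applied coordinatewise, followed by an affine output layer; its number of parameters is the number of all entries (zeros included) of all weight matrices and bias vectors, i.e. $\sum_l (d_{l-1}+1)d_l$ with $d_0=d$ and output width $1$. Let $\mathcal F_{d,P}$ be the set of functions computed by ReLU networks on $\mathbb R^d$ with at most $P$ parameters. Let $\mathbf D_{d,N,C}$ be the set of datasets $\mathcal D=\{(x_i,y_i)\}_{i=1}^N\subset\mathbb R^d\times\{1,\dots,C\}$ with pairwise distinct $x_i$ and with at least two different labels occurring. For $p\in[1,\infty]$ let $\mathcal B_p(x,r)$ be the open $\ell_p$-ball, and put $$\gamma_p=d^{|1/2-1/p|},\qquad \epsilon_{\mathcal D,p}=\tfrac12\min\{\|x_i-x_j\|_p : y_i\ne y_j\},\qquad R_{\mathcal D,p}=\max_i\|x_i\|_p .$$ A function $f$ *$\rho$-robustly memorizes* $\mathcal D$ under the $\ell_p$-norm if $f(x')=y_i$ for all $i$ and all $x'\in\mathcal B_p(x_i,\rho\,\epsilon_{\mathcal D,p})$;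 it does so *with error at most $\eta$* if for every $i$ the probability that $f(x')\neq y_i$, for $x'$ uniform on $\mathcal B_p(x_i,\rho\,\epsilon_{\mathcal D,p})$, is at most $\eta$. **Theorem.** There are absolute constants $K>0$ and $k\in\mathbb N$ such that the following holds for all $p\in[1,\infty]$, all $d,N,C$, all $\mathcal D\in\mathbf D_{d,N,C}$ and all $\eta\in(0,1)$. Put $S=N\,d\,C\,R_{\mathcal D,p}/\epsilon_{\mathcal D,p}$ (so $S\ge1$). 1. If $0<\rho\le\frac{1}{5N\sqrt d\,\gamma_p}$, there is $f\in\mathcal F_{d,P}$ with $P\le K(\sqrt N+d)(1+\log S)^k$ that $\rho$-robustly memorizes $\mathcal D$ under the $\ell_p$-norm. 2. If $\frac{1}{5N\sqrt d\,\gamma_p}<\rho\le\frac1{5\sqrt d\,\gamma_p}$, there is $f\in\mathcal F_{d,P}$ with $P\le K\big(N d^{1/4}\rho^{1/2}\gamma_p^{1/2}+d\big)(1+\log S)^k$ that $\rho$-robustly memorizes $\mathcal D$ under the $\ell_p$-norm with error at most $\eta$. 3. If $\frac1{5\sqrt d\,\gamma_p}<\rho<\frac1{\gamma_p}$, there is $f\in\mathcal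 F_{d,P}$ with $P\le K\big(N d^2\rho^4\gamma_p^4+d\big)\Big(1+\log\frac{S}{1-\rho\gamma_p}\Big)^k$ that $\rho$-robustly memorizes $\mathcal D$ under the $\ell_p$-norm. -/

import Mathlib

open MeasureTheory
open scoped ENNReal

/-- A fully connected ReLU network `ℝⁿ → ℝ`: finitely many hidden layers `a ↦ σ (W a + b)` of
positive width, followed by an affine output layer `a ↦ w ⬝ a + b`. -/
inductive ReLUNet : ℕ → Type
  | output {n : ℕ} (w : Fin n → ℝ) (b : ℝ) : ReLUNet n
  | hidden {n m : ℕ} (hm : 0 < m) (W : Matrix (Fin m) (Fin n) ℝ) (b : Fin m → ℝ)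
      (next : ReLUNet m) : ReLUNet n

namespace ReLUNet

/-- The function computed by the network. -/
noncomputable def eval : {n : ℕ} → ReLUNet n → (Fin n → ℝ) → ℝ
  | _, output w b, x => w ⬝ᵥ x + b
  | _, hidden _ W b next, x => next.eval (fun i => max (W.mulVec x i + b i) 0)

/-- The number of all weights and biases, zero entries included, that is
`∑ₗ (dₗ₋₁ + 1) dₗ` over the layers. -/
def numParams : {n : ℕ} → ReLUNet n → ℕ
  | n, output _ _ => n + 1
  | n, hidden (m := m) _ _ _ next => (n + 1) * m + next.numParams

end ReLUNet

/-- The functions `ℝᵈ → ℝ` computed by ReLU networks with at most `P` parameters. -/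
def reluClass (d P : ℕ) : Set ((Fin d → ℝ) → ℝ) :=
  {f | ∃ net : ReLUNet d, net.numParams ≤ P ∧ f = net.eval}

/-- Datasets of `N` distinct points of `ℝᵈ` with labels in `{1, …, C}`, not all labels equal. -/
structure Dataset (d N C : ℕ) where
  x : Fin N → Fin d → ℝ
  y : Fin N → ℕ
  x_injective : Function.Injective x
  y_mem : ∀ i, 1 ≤ y i ∧ y i ≤ C
  exists_ne : ∃ i j, y i ≠ y j

/-- The `ℓ_p` norm on `ℝᵈ`, for `p ∈ [1, ∞]`. -/
noncomputable def ellNorm (p : ℝ≥0∞) {d : ℕ} (v : Fin d → ℝ) : ℝ :=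
  ‖WithLp.toLp p v‖

/-- The open `ℓ_p` ball. -/
def ellBall (p : ℝ≥0∞) {d : ℕ} (c : Fin d → ℝ) (r : ℝ) : Set (Fin d → ℝ) :=
  {z | ellNorm p (z - c) < r}

/-- `γ_p(d) = d ^ |1/2 - 1/p|`, with `1/∞ = 0`. -/
noncomputable def gammaP (p : ℝ≥0∞) (d : ℕ) : ℝ :=
  (d : ℝ) ^ |(1 / 2 : ℝ) - (p⁻¹).toReal|

namespace Dataset

variable {d N C : ℕ}

/-- The separation constant: half of the least `ℓ_p` distance between two points with different
labels (the infimum is over a nonempty finite set, hence a minimum). -/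
noncomputable def sep (D : Dataset d N C) (p : ℝ≥0∞) : ℝ :=
  (1 / 2) * sInf {r | ∃ i j, D.y i ≠ D.y j ∧ r = ellNorm p (D.x i - D.x j)}

/-- The radius of the dataset: the largest `ℓ_p` norm of a data point. -/
noncomputable def radius (D : Dataset d N C) (p : ℝ≥0∞) : ℝ :=
  ⨆ i, ellNorm p (D.x i)

/-- `f` takes the value `y_i` on the whole open `ℓ_p` ball around `x_i` of radius `ρ ε_{D,p}`,
for every `i`. -/
def RobustlyMemorizes (D : Dataset d N C) (p : ℝ≥0∞) (ρ : ℝ) (f : (Fin d → ℝ) → ℝ) : Prop :=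
  ∀ i, ∀ z ∈ ellBall p (D.x i) (ρ * D.sep p), f z = D.y i

/-- The `ρ`-robust error of `f`: the largest over `i` of the probability that `f z ≠ y_i`, where
`z` is uniformly distributed on the open `ℓ_p` ball around `x_i` of radius `ρ ε_{D,p}`. -/
noncomputable def robustError (D : Dataset d N C) (p : ℝ≥0∞) (ρ : ℝ) (f : (Fin d → ℝ) → ℝ) :
    ℝ≥0∞ :=
  ⨆ i, ProbabilityTheory.cond (volume : Measure (Fin d → ℝ)) (ellBall p (D.x i) (ρ * D.sep p))
    {z | f z ≠ D.y i}

/-- The quantity `N d C R / ε`, at least `1`, in which the suppressed factors are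
polylogarithmic. -/
noncomputable def scale (D : Dataset d N C) (p : ℝ≥0∞) : ℝ :=
  (N : ℝ) * d * C * (D.radius p / D.sep p)

end Dataset

/-! All networks are obtained from register programs: states of nonnegative numbers, changed one
register at a time by an affine map plus three ReLU neurons. `Prog.exists_reluNet` compiles `T`
updates on `w` registers into `O(d w + T w ^ 2)` parameters, so for `w` polylogarithmic only the
running time and an additive `d` matter. Norm comparison (`exists_scale_ellNorm`) turns an `ℓ_p`
ball of radius `ρ ε_p` into a subset of a Euclidean ball of radius `ρ γ_p ε`, with `ε` a lower bound
for the Euclidean separation.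

For `ρ γ_p` up to `1 / (5 √d)`, about `log N` random signed coordinate sums, scaled by `1 / ε`, put
points with different labels at distance at least `6 / 5` in some projection, while a ball moves
each projection by at most `1 / (5 n)`, where `n ≤ 1 / (5 √d ρ γ_p)`. By pigeonhole a shift of the
unit grid keeps `n` given points so far from cell boundaries that their balls do not cross them
(`exists_offset`). Integer parts of the projections are then extracted bit by bit, hashed to one
integer key, and the label is looked up. Lookup of `n` keys costs only about `√n` steps: the sorted
keys are cut into `√n` blocks, a step function fetches a block packed into one number, and its `√n`
digits are decoded and compared with the key (`exists_memorize`). If `n = N`, one grid suffices.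
Otherwise there are about `N / n` groups, each with its own grid, and the maximum of the labels
found is taken: a foreign grid yields either the right label or `0`. Balls may meet thin zones below
the integers of foreign grids, where bit extraction fails; these have arbitrarily small measure, and
their width does not enter the parameter count. The cost is `(N / n) √n = N / √n`.

For larger `ρ`, labels are decided by distances. A linear map to `W` dimensions, with `W` about `min
N d * (ρ γ_p) ^ 2` up to logarithms, keeps the separation and keeps the balls smaller than it
(`exists_rows`). The squared norm of the image is approximated once by iterated tent maps; given it,
the squared distance to each data point is affine, and a maximum of tents returns the label
(`exists_ball_net`). With width `W` and about `N` steps this costs `N W ^ 2`. -/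

/-! ### Register programs and their compilation to ReLU networks -/

section Programs

variable {ι : Type*} [Fintype ι]

/-- Affine functionals on a finite coordinate space. -/
def IsAff (f : (ι → ℝ) → ℝ) : Prop :=
  ∃ (w : ι → ℝ) (b : ℝ), ∀ a, f a = ∑ j, w j * a j + b

theorem IsAff.const (c : ℝ) : IsAff (fun _ : ι → ℝ => c) := ⟨0, c, by simp⟩

theorem IsAff.proj (i : ι) : IsAff (fun a : ι → ℝ => a i) := by
  classical
  exact ⟨Pi.single i 1, 0, fun a => by simp [Pi.single_apply]⟩

theorem IsAff.add {f g : (ι → ℝ) → ℝ} (hf : IsAff f) (hg : IsAff g) :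
    IsAff (fun a => f a + g a) := by
  obtain ⟨w, b, h⟩ := hf
  obtain ⟨w', b', h'⟩ := hg
  refine ⟨w + w', b + b', fun a => ?_⟩
  simp only [h, h', Pi.add_apply, add_mul, Finset.sum_add_distrib]
  ring

theorem IsAff.const_mul (c : ℝ) {f : (ι → ℝ) → ℝ} (hf : IsAff f) : IsAff (fun a => c * f a) := by
  obtain ⟨w, b, h⟩ := hf
  refine ⟨fun j => c * w j, c * b, fun a => ?_⟩
  simp only [h, mul_add, Finset.mul_sum, mul_assoc]

theorem IsAff.neg {f : (ι → ℝ) → ℝ} (hf : IsAff f) : IsAff (fun a => - f a) := by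
  simpa using hf.const_mul (-1)

theorem IsAff.sub {f g : (ι → ℝ) → ℝ} (hf : IsAff f) (hg : IsAff g) :
    IsAff (fun a => f a - g a) := by
  simpa only [sub_eq_add_neg] using hf.add hg.neg

theorem IsAff.sum {κ : Type*} (s : Finset κ) {f : κ → (ι → ℝ) → ℝ} (hf : ∀ k, IsAff (f k)) :
    IsAff (fun a => ∑ k ∈ s, f k a) := by
  classical
  induction s using Finset.induction_on with
  | empty => simpa using IsAff.const 0
  | insert k s hk ih => simpa only [Finset.sum_insert hk] using (hf k).add ih

/-- Functions computed by an affine skip connection and three ReLU neurons. -/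
def Shallow (f : (ι → ℝ) → ℝ) : Prop :=
  ∃ (l : (ι → ℝ) → ℝ) (V : Fin 3 → ℝ) (M : Fin 3 → (ι → ℝ) → ℝ),
    IsAff l ∧ (∀ k, IsAff (M k)) ∧ ∀ a, f a = l a + ∑ k, V k * max (M k a) 0

theorem IsAff.shallow {f : (ι → ℝ) → ℝ} (hf : IsAff f) : Shallow f :=
  ⟨f, 0, fun _ _ => 0, hf, fun _ => IsAff.const 0, by simp⟩

theorem Shallow.of_neurons {l m₀ m₁ m₂ : (ι → ℝ) → ℝ} (v₀ v₁ v₂ : ℝ) (hl : IsAff l)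
    (h₀ : IsAff m₀) (h₁ : IsAff m₁) (h₂ : IsAff m₂) :
    Shallow (fun a => l a + (v₀ * max (m₀ a) 0 + v₁ * max (m₁ a) 0 + v₂ * max (m₂ a) 0)) := by
  refine ⟨l, ![v₀, v₁, v₂], ![m₀, m₁, m₂], hl, ?_, fun a => ?_⟩
  · intro k
    fin_cases k <;> assumption
  · simp [Fin.sum_univ_three]

/-- `Prog T F`: the map `F` on states is a composition of `T` updates of single registers, each
by the positive part of a shallow function of the state. -/
inductive Prog [DecidableEq ι] : ℕ → ((ι → ℝ) → ι → ℝ) → Prop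
  | nil : Prog 0 id
  | snoc {T : ℕ} {F : (ι → ℝ) → ι → ℝ} (x : ι) {f : (ι → ℝ) → ℝ} (hF : Prog T F)
      (hf : Shallow f) :
      Prog (T + 1) (fun a => Function.update (F a) x (max (f (F a)) 0))

namespace Prog

variable [DecidableEq ι]

/-- Needed for compilation: a ReLU layer copies a register unchanged exactly because its content is
nonnegative. -/
theorem nonneg {T : ℕ} {F : (ι → ℝ) → ι → ℝ} (h : Prog T F) {a : ι → ℝ} (ha : ∀ i, 0 ≤ a i) :
    ∀ i, 0 ≤ F a i := by
  induction h with
  | nil => exact ha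
  | snoc x _ _ ih =>
    intro i
    by_cases hi : i = x
    · subst hi; simp
    · simpa [hi] using ih i

theorem comp {T T' : ℕ} {F G : (ι → ℝ) → ι → ℝ} (hF : Prog T F) (hG : Prog T' G) :
    Prog (T + T') (fun a => G (F a)) := by
  induction hG with
  | nil => exact hF
  | snoc x _ hf ih => exact ih.snoc x hf

theorem single (x : ι) {f : (ι → ℝ) → ℝ} (hf : Shallow f) :
    Prog 1 (fun a => Function.update a x (max (f a) 0)) :=
  nil.snoc x hf

/-- The composition of the first `n` members of a sequence of state maps. -/
def loop (F : ℕ → (ι → ℝ) → ι → ℝ) : ℕ → (ι → ℝ) → ι → ℝ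
  | 0 => id
  | n + 1 => fun a => F n (loop F n a)

theorem loop_prog {F : ℕ → (ι → ℝ) → ι → ℝ} {T : ℕ} (h : ∀ n, Prog T (F n)) (n : ℕ) :
    Prog (n * T) (loop F n) := by
  induction n with
  | zero => simpa [loop] using (nil : Prog 0 (id : (ι → ℝ) → ι → ℝ))
  | succ n ih => simpa [loop, Nat.succ_mul] using ih.comp (h n)

end Prog

/-- A hidden layer between spaces indexed by arbitrary finite types. -/
theorem exists_hidden_layer {α β : Type*} [Fintype α] {n : ℕ} (eα : α ≃ Fin n) {m : ℕ} (eβ : β ≃ Fin m) (hm : 0 < m)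
    (next : ReLUNet m) {f : β → (α → ℝ) → ℝ} (hf : ∀ j, IsAff (f j)) :
    ∃ net : ReLUNet n, net.numParams = (n + 1) * m + next.numParams ∧
      ∀ a : α → ℝ, net.eval (a ∘ eα.symm) = next.eval ((fun j => max (f j a) 0) ∘ eβ.symm) := by
  choose w b h using hf
  refine ⟨ReLUNet.hidden hm (fun j i => w (eβ.symm j) (eα.symm i)) (fun j => b (eβ.symm j)) next,
    rfl, fun a => ?_⟩
  simp only [ReLUNet.eval]
  congr 1
  ext j
  simp only [Function.comp, h, Matrix.mulVec, dotProduct]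
  congr 2
  exact Equiv.sum_comp eα.symm (fun i => w (eβ.symm j) i * a i)

/-- An update costs two layers: one of width `w + 3` copies the registers and evaluates the three
neurons, one of width `w` recombines them. The last update of the program is put in front of `next`
first, hence the induction over all `next`. -/
theorem Prog.exists_net [DecidableEq ι] {w : ℕ} (e : ι ≃ Fin w) (hw : 0 < w)
    (next : ReLUNet w) {T : ℕ} {F : (ι → ℝ) → ι → ℝ} (h : Prog T F) :
    ∃ net : ReLUNet w, net.numParams = T * ((w + 1) * (w + 3) + (w + 4) * w) + next.numParams ∧
      ∀ a : ι → ℝ, (∀ i, 0 ≤ a i) → net.eval (a ∘ e.symm) = next.eval (F a ∘ e.symm) := by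
  induction h generalizing next with
  | nil => exact ⟨next, by simp, fun a _ => rfl⟩
  | @snoc T F x f hF hf ih =>
    obtain ⟨l, V, M, ⟨lw, lb, hl⟩, hM, hf⟩ := hf
    let e' : ι ⊕ Fin 3 ≃ Fin (w + 3) := (Equiv.sumCongr e (Equiv.refl _)).trans finSumFinEquiv
    have h2 : ∀ i : ι, IsAff (fun s : ι ⊕ Fin 3 → ℝ =>
        if i = x then l (fun j => s (Sum.inl j)) + ∑ k, V k * s (Sum.inr k)
        else s (Sum.inl i)) := by
      intro i
      split_ifs
      · simp only [hl]
        exact ((IsAff.sum _ fun k => (IsAff.proj _).const_mul _).add (.const _)).add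
          (IsAff.sum _ fun k => (IsAff.proj _).const_mul _)
      · exact IsAff.proj _
    obtain ⟨n₂, hn₂, he₂⟩ := exists_hidden_layer e' e hw next h2
    have h1 : ∀ i : ι ⊕ Fin 3, IsAff (Sum.elim (fun j (a : ι → ℝ) => a j) M i) := by
      rintro (i | i)
      · exact IsAff.proj i
      · exact hM i
    obtain ⟨n₁, hn₁, he₁⟩ := exists_hidden_layer e e' (by lia) n₂ h1
    obtain ⟨n₀, hn₀, he₀⟩ := ih n₁
    refine ⟨n₀, by rw [hn₀, hn₁, hn₂]; ring, fun a ha => ?_⟩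
    rw [he₀ a ha, he₁, he₂]
    congr 1
    ext j
    have hn := hF.nonneg ha
    simp only [Function.comp, Sum.elim_inl, Sum.elim_inr, max_eq_left (hn _)]
    by_cases hj : e.symm j = x
    · rw [if_pos hj, hj, Function.update_self, hf]
    · rw [if_neg hj, Function.update_of_ne hj, max_eq_left (hn _)]

/-- A register program, fed by affine functionals of the input and read off in one register, is
computed by a ReLU network. -/
theorem Prog.exists_reluNet [DecidableEq ι] {d T : ℕ} {F : (ι → ℝ) → ι → ℝ} (h : Prog T F)
    {A : ι → (Fin d → ℝ) → ℝ} (hA : ∀ i, IsAff (A i)) (o : ι) :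
    ∃ net : ReLUNet d,
      net.numParams ≤ (d + 2) * (Fintype.card ι + 1) + 2 * T * (Fintype.card ι + 4) ^ 2 ∧
      ∀ z, net.eval z = F (fun i => max (A i z) 0) o := by
  set w := Fintype.card ι with hw
  have hw0 : 0 < w := Fintype.card_pos_iff.2 ⟨o⟩
  let e : ι ≃ Fin w := Fintype.equivFin ι
  obtain ⟨n₁, hn₁, he₁⟩ := h.exists_net e hw0 (ReLUNet.output (Pi.single (e o) 1) 0)
  obtain ⟨n₀, hn₀, he₀⟩ := exists_hidden_layer (Equiv.refl (Fin d)) e hw0 n₁ hA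
  refine ⟨n₀, ?_, fun z => ?_⟩
  · rw [hn₀, hn₁]
    simp only [ReLUNet.numParams]
    nlinarith [Nat.zero_le (T * w), Nat.zero_le T]
  · have := he₀ z
    simp only [Equiv.refl_symm, Equiv.coe_refl, Function.comp_id] at this
    rw [this, he₁ _ (fun i => le_max_right _ _)]
    have hs : (Pi.single (e o) 1 : Fin w → ℝ) ∘ e = Pi.single o 1 := by
      ext i
      simp [Pi.single_apply]
    simp [ReLUNet.eval, hs]

end Programs

/-! ### Bit extraction -/

section Ramp

/-- The piecewise linear approximation of the indicator of `[c, ∞)` with a ramp of width `w`. -/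
noncomputable def ramp (c w x : ℝ) : ℝ := w⁻¹ * max (x - c + w) 0 + -w⁻¹ * max (x - c) 0

theorem ramp_eq_one {c w x : ℝ} (hw : 0 < w) (h : c ≤ x) : ramp c w x = 1 := by
  rw [ramp, max_eq_left (by linarith), max_eq_left (by linarith)]
  field_simp
  ring

theorem ramp_eq_zero {c w x : ℝ} (hw : 0 < w) (h : x ≤ c - w) : ramp c w x = 0 := by
  rw [ramp, max_eq_right (by linarith), max_eq_right (by linarith)]
  simp

/-- For `u` an integer, `window C u` is `u` if `0 ≤ u ≤ C`, and `0` otherwise. -/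
noncomputable def window (C u : ℝ) : ℝ :=
  1 * max u 0 + -(C + 1) * max (u - C) 0 + C * max (u - C - 1) 0

theorem window_eq_self {C u : ℝ} (h₀ : 0 ≤ u) (h₁ : u ≤ C) : window C u = u := by
  rw [window, max_eq_left h₀, max_eq_right (by linarith), max_eq_right (by linarith)]
  ring

theorem window_eq_zero_of_nonpos {C u : ℝ} (hC : 0 ≤ C) (h₀ : u ≤ 0) : window C u = 0 := by
  rw [window, max_eq_right h₀, max_eq_right (by linarith), max_eq_right (by linarith)]
  ring

theorem window_eq_zero_of_lt {C u : ℝ} (hC : 0 ≤ C) (h₀ : C + 1 ≤ u) : window C u = 0 := by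
  rw [window, max_eq_left (by linarith), max_eq_left (by linarith), max_eq_left (by linarith)]
  ring

end Ramp

/-! ### Programs that read, hash, tabulate and decode binary digits -/

section Extraction

variable {ι : Type*} [Fintype ι]

theorem Shallow.add_ramp {l m : (ι → ℝ) → ℝ} (hl : IsAff l) (hm : IsAff m) (v c w : ℝ) :
    Shallow (fun a => l a + v * ramp c w (m a)) := by
  have := Shallow.of_neurons (v * w⁻¹) (v * -w⁻¹) 0 hl ((hm.sub (.const c)).add (.const w))
    (hm.sub (.const c)) (IsAff.const 0)
  convert this using 2
  simp only [ramp]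
  ring

theorem Shallow.add_window {l m : (ι → ℝ) → ℝ} (hl : IsAff l) (hm : IsAff m) (C : ℝ) :
    Shallow (fun a => l a + window C (m a)) :=
  Shallow.of_neurons 1 (-(C + 1)) C hl hm (hm.sub (.const C)) ((hm.sub (.const C)).sub (.const 1))

variable [DecidableEq ι]

/-- One binary digit of the register `X` is moved to the register `A`. -/
theorem exists_bit_step {X B A : ι} (hXB : X ≠ B) (hXA : X ≠ A) (hBA : B ≠ A) (c w α : ℝ) :
    ∃ F, Prog 4 F ∧ ∀ a : ι → ℝ, (∀ i, 0 ≤ a i) → a B = 0 → ∀ bit : ℝ, 0 ≤ bit →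
      ramp c w (a X) = bit → 0 ≤ a X - c * bit → 0 ≤ a A + α * bit →
      F a = Function.update (Function.update a X (a X - c * bit)) A (a A + α * bit) := by
  have h1 : Shallow (fun a : ι → ℝ => 0 + 1 * ramp c w (a X)) :=
    Shallow.add_ramp (.const 0) (.proj X) _ _ _
  have h2 : Shallow (fun a : ι → ℝ => a X - c * a B) :=
    ((IsAff.proj X).sub ((IsAff.proj B).const_mul c)).shallow
  have h3 : Shallow (fun a : ι → ℝ => a A + α * a B) :=
    ((IsAff.proj A).add ((IsAff.proj B).const_mul α)).shallow
  have h4 : Shallow (fun _ : ι → ℝ => (0 : ℝ)) := (IsAff.const 0).shallow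
  refine ⟨_, (((Prog.single B h1).snoc X h2).snoc A h3).snoc B h4, ?_⟩
  intro a _ hB bit hbit hr h0 h0'
  funext i
  simp only [Function.update_apply, hXB, hXB.symm, hBA.symm, hXA.symm, hr, if_false, if_true,
    zero_add, one_mul, max_eq_left hbit, max_eq_left h0, max_eq_left h0', max_self]
  by_cases hi : i = B
  · subst hi
    simp [hBA, hXB.symm, hB]
  · simp [hi]

/-- The integer part, in units of `c`, of the register `X` is moved, with the factor `α`, to the
register `A`. The fractional part must not exceed `c - w`. -/
theorem exists_extract {X B A : ι} (hXB : X ≠ B) (hXA : X ≠ A) (hBA : B ≠ A) {c w α : ℝ}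
    (hc : 0 < c) (hw : 0 < w) (hα : 0 ≤ α) (n : ℕ) :
    ∃ F, Prog (4 * n) F ∧ ∀ a : ι → ℝ, (∀ i, 0 ≤ a i) → a B = 0 → ∀ (q : ℕ) (r : ℝ),
      q < 2 ^ n → 0 ≤ r → r ≤ c - w → a X = c * q + r →
      F a = Function.update (Function.update a X r) A (a A + α * q) := by
  induction n with
  | zero =>
    refine ⟨_, Prog.nil, fun a _ _ q r hq _ _ hX => ?_⟩
    obtain rfl : q = 0 := by simpa using hq
    have : a X = r := by simpa using hX
    subst this
    simp
  | succ n ih =>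
    obtain ⟨F, hF, hFs⟩ := ih
    -- Bits are taken from the most significant downwards.
    obtain ⟨G, hG, hGs⟩ := exists_bit_step hXB hXA hBA (c * 2 ^ n) w (α * 2 ^ n)
    refine ⟨_, by simpa [mul_add, add_comm] using hG.comp hF, fun a ha hB q r hq hr hr' hX => ?_⟩
    obtain ⟨b, q', hb, hq', hqq, hram⟩ : ∃ (b q' : ℕ), b ≤ 1 ∧ q' < 2 ^ n ∧ q = 2 ^ n * b + q' ∧
        ramp (c * 2 ^ n) w (a X) = b := by
      by_cases h : 2 ^ n ≤ q
      · refine ⟨1, q - 2 ^ n, le_rfl, by rw [pow_succ] at hq; lia, by lia, ?_⟩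
        rw [ramp_eq_one hw]
        · simp
        · rw [hX]
          have : (2 ^ n : ℝ) ≤ q := by exact_mod_cast h
          nlinarith
      -- Here `q + 1 ≤ 2 ^ n` and `r ≤ c - w` leave `X` at most `c * 2 ^ n - w`, the foot of the
      -- ramp: the gap `w` makes the test exact.
      · refine ⟨0, q, by simp, by lia, by simp, ?_⟩
        rw [ramp_eq_zero hw]
        · simp
        · rw [hX]
          have : (q : ℝ) + 1 ≤ 2 ^ n := by exact_mod_cast (not_le.1 h)
          nlinarith
    have hx : a X - c * 2 ^ n * b = c * q' + r := by
      rw [hX, hqq]; push_cast; ring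
    have hG1 := hGs a ha hB b (by positivity) hram (by rw [hx]; positivity)
      (by have := ha A; positivity)
    have hn := hG.nonneg ha
    have hq2 := hFs (G a) hn (by rw [hG1]; simp [hBA, hXB.symm, hB]) q' r hq' hr hr'
      (by rw [hG1]; simp [hXA, hx])
    rw [hq2, hG1]
    funext i
    by_cases hA : i = A
    · subst hA
      simp [hqq]; ring
    · by_cases hi : i = X
      · subst hi; simp [hXA]
      · simp [hA, hi]

/-- Integer parts of the registers `U k + off k`, `k < L`, are hashed into the register `A`. -/
theorem exists_hash {X B A : ι} (hXB : X ≠ B) (hXA : X ≠ A) (hBA : B ≠ A) (U : ℕ → ι)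
    (hUA : ∀ k, U k ≠ A) (off : ℕ → ℝ) {w : ℝ} (hw : 0 < w) (n L : ℕ) :
    ∃ F, Prog (L * (4 * n + 2)) F ∧ ∀ a : ι → ℝ, (∀ i, 0 ≤ a i) → a B = 0 → a X = 0 →
      ∀ (q : ℕ → ℕ) (r : ℕ → ℝ),
      (∀ k < L, q k < 2 ^ n ∧ 0 ≤ r k ∧ r k ≤ 1 - w ∧ a (U k) + off k = q k + r k) →
      F a = Function.update a A (a A + ∑ k ∈ Finset.range L, ((2 ^ n) ^ k * q k : ℕ)) := by
  have hstep : ∀ k : ℕ, ∃ F, Prog (4 * n + 2) F ∧ ∀ a : ι → ℝ, (∀ i, 0 ≤ a i) → a B = 0 →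
      a X = 0 → ∀ (q : ℕ) (r : ℝ), q < 2 ^ n → 0 ≤ r → r ≤ 1 - w → a (U k) + off k = q + r →
      F a = Function.update a A (a A + ((2 ^ n) ^ k * q : ℕ)) := by
    intro k
    have h1 : Shallow (fun a : ι → ℝ => a (U k) + off k) :=
      ((IsAff.proj _).add (.const _)).shallow
    have h2 : Shallow (fun _ : ι → ℝ => (0 : ℝ)) := (IsAff.const 0).shallow
    obtain ⟨F, hF, hFs⟩ := exists_extract hXB hXA hBA (c := 1) (w := w) (α := (2 ^ n) ^ k)
      one_pos hw (by positivity) n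
    have hP := ((Prog.single X h1).comp hF).snoc X h2
    refine ⟨_, by convert hP using 1; ring, fun a ha hB hX q r hq hr hr' hU => ?_⟩
    have h0 : 0 ≤ a (U k) + off k := by rw [hU]; positivity
    rw [hFs _ ((Prog.single X h1).nonneg ha) (by simp [hXB.symm, hB]) q r hq hr hr'
      (by rw [Function.update_self, max_eq_left h0, hU, one_mul])]
    funext i
    by_cases hi : i = A
    · subst hi; simp [hXA.symm]
    · by_cases hi' : i = X
      · subst hi'; simp [hXA, hX]
      · simp [hi, hi']
  choose F hF hFs using hstep
  refine ⟨Prog.loop F L, Prog.loop_prog hF L, fun a ha hB hX q r h => ?_⟩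
  clear hF
  induction L with
  | zero => simp [Prog.loop]
  | succ L ih =>
    have hi := ih (fun k hk => h k (by lia))
    obtain ⟨h1, h2, h3, h4⟩ := h L (by lia)
    simp only [Prog.loop]
    rw [hi, hFs L _ ?_ (by simp [hBA, hB]) (by simp [hXA, hX]) (q L) (r L) h1 h2 h3
      (by simp [hUA, h4])]
    · simp only [Function.update_self, Function.update_idem, Finset.sum_range_succ]
      push_cast
      rw [add_assoc]
    · intro i
      have hn := ha A
      by_cases hi : i = A
      · subst hi; simp only [Function.update_self]; positivity
      · simpa [hi] using ha i

/-- A step function of a natural number with at most `J` jumps is tabulated. -/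
theorem exists_lookup {A E : ι} (hAE : A ≠ E) {g : ℕ → ℕ} (hg : Monotone g) (v : ℕ → ℕ) (J : ℕ) :
    ∃ F, Prog (J + 1) F ∧ ∀ a : ι → ℝ, (∀ i, 0 ≤ a i) → ∀ t : ℕ, a A = t → g t ≤ J →
      F a = Function.update a E (v (g t)) := by
  -- Truncation at `J` makes the induction run: raising `J` by one adds a single jump.
  suffices H : ∃ F, Prog (J + 1) F ∧ ∀ a : ι → ℝ, (∀ i, 0 ≤ a i) → ∀ t : ℕ, a A = t →
      F a = Function.update a E (v (min (g t) J)) by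
    obtain ⟨F, hF, h⟩ := H
    exact ⟨F, hF, fun a ha t ht hJ => by rw [h a ha t ht, min_eq_left hJ]⟩
  induction J with
  | zero =>
    refine ⟨_, Prog.single E (IsAff.const (v 0 : ℝ)).shallow, fun a _ t _ => ?_⟩
    simp
  | succ J ih =>
    obtain ⟨F, hF, hFs⟩ := ih
    by_cases hex : ∃ t, J + 1 ≤ g t
    · have hmin : ∀ t, J + 1 ≤ g t ↔ Nat.find hex ≤ t := fun t =>
        ⟨fun h => Nat.find_min' hex h, fun h => (Nat.find_spec hex).trans (hg h)⟩
      -- The jump occurs at the first argument where `g` reaches `J + 1`. The argument is an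
      -- integer, so a ramp of width `1` is an exact step.
      set τ := Nat.find hex
      refine ⟨_, hF.snoc E (Shallow.add_ramp (IsAff.proj E) (IsAff.proj A)
        ((v (J + 1) : ℝ) - v J) τ 1), fun a ha t ht => ?_⟩
      simp only [hFs a ha t ht, Function.update_self, Function.update_idem,
        Function.update_of_ne hAE, ht]
      congr 1
      by_cases h : J + 1 ≤ g t
      · rw [ramp_eq_one one_pos (by exact_mod_cast (hmin t).1 h), min_eq_right (by lia),
          min_eq_right h]
        simp
      · have h' : t + 1 ≤ τ := by
          by_contra hc
          exact h ((hmin t).2 (by lia))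
        rw [ramp_eq_zero one_pos, min_eq_left (by lia), min_eq_left (by lia)]
        · simp
        · have : ((t : ℝ) + 1) ≤ τ := by exact_mod_cast h'
          linarith
    -- No such jump exists; an idle update keeps the step count.
    · push Not at hex
      refine ⟨_, hF.snoc E (IsAff.proj E).shallow, fun a ha t ht => ?_⟩
      have := hex t
      simp only [hFs a ha t ht, Function.update_self, Function.update_idem]
      rw [min_eq_left (by lia), min_eq_left (by lia)]
      simp

theorem sum_digits_lt {b : ℕ} {D : ℕ → ℕ} (hD : ∀ i, D i < 2 ^ b) (s : ℕ) :
    ∑ i ∈ Finset.range s, D i * (2 ^ b) ^ i + 1 ≤ (2 ^ b) ^ s := by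
  induction s with
  | zero => simp
  | succ s ih =>
    rw [Finset.sum_range_succ, pow_succ (2 ^ b) s]
    have h := Nat.mul_le_mul_right ((2 ^ b) ^ s) (Nat.succ_le_of_lt (hD s))
    simp only [Nat.succ_eq_add_one] at h
    linarith

/-- The digits `D 0, …, D (s - 1)` in base `2 ^ b` of the register `E` are decoded one by one and
compared with the register `A`. -/
theorem exists_decode {A E B V S : ι} (hEB : E ≠ B) (hEV : E ≠ V) (hBV : B ≠ V) (hSE : S ≠ E)
    (hSV : S ≠ V) (hSB : S ≠ B) (hAE : A ≠ E) (hAV : A ≠ V) (hAS : A ≠ S) (b C s : ℕ) :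
    ∃ F, Prog (s * (4 * b + 2)) F ∧ ∀ a : ι → ℝ, (∀ i, 0 ≤ a i) → a B = 0 → a V = 0 →
      ∀ D : ℕ → ℕ, (∀ i, D i < 2 ^ b) →
      a E = (∑ i ∈ Finset.range s, D i * (2 ^ b) ^ i : ℕ) →
      (∀ i, 0 ≤ window C (D i - (C + 1) * a A)) →
      F a = Function.update (Function.update a E 0) S
        (a S + ∑ i ∈ Finset.range s, window C (D i - (C + 1) * a A)) := by
  induction s with
  | zero =>
    refine ⟨id, by simpa using Prog.nil, fun a _ _ _ D _ hE _ => ?_⟩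
    have : a E = 0 := by simpa using hE
    simp [← this]
  | succ s ih =>
    obtain ⟨F, hF, hFs⟩ := ih
    -- The top digit is read in units of `(2 ^ b) ^ s`. The lower digits form an integer below this
    -- unit, which leaves the gap `w = 1`.
    obtain ⟨G, hG, hGs⟩ := exists_extract hEB hEV hBV (c := (2 ^ b) ^ s) (w := 1) (α := 1)
      (by positivity) one_pos zero_le_one b
    have h1 : Shallow (fun a : ι → ℝ => a S + window C (a V - (C + 1) * a A)) :=
      Shallow.add_window (.proj S) ((IsAff.proj V).sub ((IsAff.proj A).const_mul _)) _
    have hP := (((hG.snoc S h1).snoc V (IsAff.const 0).shallow)).comp hF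
    refine ⟨_, by convert hP using 1; ring, fun a ha hB hV D hD hE hwin => ?_⟩
    have hlt := sum_digits_lt hD s
    have hG1 := hGs a ha hB (D s) (∑ i ∈ Finset.range s, D i * (2 ^ b) ^ i : ℕ) (hD s)
      (by positivity) (by
        have : ((∑ i ∈ Finset.range s, D i * (2 ^ b) ^ i : ℕ) : ℝ) + 1 ≤ (2 ^ b) ^ s := by
          exact_mod_cast hlt
        linarith) (by
        rw [hE, Finset.sum_range_succ]; push_cast; ring)
    have hn := hG.nonneg ha
    set a₁ := G a with ha₁
    have hE1 : a₁ E = (∑ i ∈ Finset.range s, D i * (2 ^ b) ^ i : ℕ) := by rw [hG1]; simp [hEV]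
    have hV1 : a₁ V = D s := by rw [hG1]; simp [hV]
    have ho1 : ∀ i, i ≠ E → i ≠ V → a₁ i = a i := fun i h h' => by rw [hG1]; simp [h, h']
    clear_value a₁
    have hw0 : 0 ≤ a S + window C (D s - (C + 1) * a A) := add_nonneg (ha S) (hwin s)
    have hstate : Function.update (Function.update a₁ S
        (max (a₁ S + window C (a₁ V - (C + 1) * a₁ A)) 0)) V (max 0 0) =
        Function.update (Function.update a E (∑ i ∈ Finset.range s, D i * (2 ^ b) ^ i : ℕ)) S
          (a S + window C (D s - (C + 1) * a A)) := by
      rw [ho1 S hSE hSV, hV1, ho1 A hAE hAV, max_eq_left hw0, max_self]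
      funext i
      by_cases h1 : i = V
      · subst h1; simp [hSV.symm, hEV.symm, hV]
      · by_cases h2 : i = S
        · subst h2; simp [hSV]
        · by_cases h3 : i = E
          · subst h3; simp [h1, h2, hE1]
          · simp [h1, h2, h3, ho1]
    simp only [hstate]
    rw [hFs _ ?_ (by simp [hSB.symm, hEB.symm, hB]) (by simp [hSV.symm, hEV.symm, hV]) D hD
      (by simp [hSE.symm]) (by simpa [hAS, hAE] using hwin)]
    · funext i
      by_cases h2 : i = S
      · subst h2
        simp [hAS, hAE, Finset.sum_range_succ]
        ring
      · by_cases h3 : i = E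
        · subst h3; simp [h2]
        · simp [h2, h3]
    · intro i
      by_cases h2 : i = S
      · subst h2; simpa using hw0
      · by_cases h3 : i = E
        · subst h3; simp only [Function.update_of_ne h2, Function.update_self]; positivity
        · simpa [h2, h3] using ha i

end Extraction

/-! ### Memorization of integer keys -/

section Memorize

variable {ι : Type*} [Fintype ι] [DecidableEq ι]

/-- The number of keys below `t`. -/
def keyRank (K : Finset ℕ) (t : ℕ) : ℕ := (K.filter (· < t)).card

theorem keyRank_mono (K : Finset ℕ) : Monotone (keyRank K) := fun _ _ h =>
  Finset.card_le_card fun _ hx => by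
    simp only [Finset.mem_filter] at hx ⊢
    exact ⟨hx.1, hx.2.trans_le h⟩

theorem keyRank_lt {K : Finset ℕ} {t u : ℕ} (ht : t ∈ K) (h : t < u) :
    keyRank K t < keyRank K u := by
  refine Finset.card_lt_card (Finset.ssubset_iff.2 ⟨t, by simp, ?_⟩)
  intro x hx
  simp only [Finset.mem_insert, Finset.mem_filter] at hx ⊢
  rcases hx with rfl | hx
  · exact ⟨ht, h⟩
  · exact ⟨hx.1, hx.2.trans h⟩

theorem keyRank_injOn (K : Finset ℕ) : Set.InjOn (keyRank K) K := by
  intro t ht u hu h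
  rcases lt_trichotomy t u with hlt | hlt | hlt
  · exact absurd h (keyRank_lt ht hlt).ne
  · exact hlt
  · exact absurd h.symm (keyRank_lt hu hlt).ne

/-- A key and its label, packed into one digit; `0` if there is no key of that rank. -/
noncomputable def keyDigit (K : Finset ℕ) (lab : ℕ → ℕ) (C r : ℕ) : ℕ :=
  open Classical in
  if h : ∃ t ∈ K, keyRank K t = r then h.choose * (C + 1) + lab h.choose else 0

theorem keyDigit_keyRank {K : Finset ℕ} (lab : ℕ → ℕ) (C : ℕ) {t : ℕ} (ht : t ∈ K) :
    keyDigit K lab C (keyRank K t) = t * (C + 1) + lab t := by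
  have h : ∃ u ∈ K, keyRank K u = keyRank K t := ⟨t, ht, rfl⟩
  have := keyRank_injOn K h.choose_spec.1 ht h.choose_spec.2
  rw [keyDigit, dif_pos h, this]

/-- The argument is `(κ - t) * (C + 1) + l`, which is negative, in `[0, C]`, or at least `C + 1`
according to the sign of `κ - t`; comparing a key and reading its label are thus one operation. -/
theorem window_mul_add {C l : ℕ} (hl : l ≤ C) (κ t : ℕ) :
    window C ((κ * (C + 1) + l : ℕ) - (C + 1) * t) = if κ = t then (l : ℝ) else 0 := by
  have hl' : (l : ℝ) ≤ C := by exact_mod_cast hl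
  have hC : (0 : ℝ) ≤ C := by positivity
  have hl0 : (0 : ℝ) ≤ l := by positivity
  split_ifs with h
  · subst h
    rw [window_eq_self] <;> push_cast <;> nlinarith
  · rcases lt_or_gt_of_ne h with h | h
    · have : (κ : ℝ) + 1 ≤ t := by exact_mod_cast h
      rw [window_eq_zero_of_nonpos hC]
      push_cast
      nlinarith
    · have : (t : ℝ) + 1 ≤ κ := by exact_mod_cast h
      rw [window_eq_zero_of_lt hC]
      push_cast
      nlinarith

/-- A number that is not a key may share its rank with a key, but then its label is `0`, so the
formula needs no assumption on `t`. -/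
theorem window_keyDigit {K : Finset ℕ} {lab : ℕ → ℕ} {C : ℕ} (hC : ∀ t, lab t ≤ C)
    (h0 : ∀ t ∉ K, lab t = 0) (r t : ℕ) :
    window C (keyDigit K lab C r - (C + 1) * t) =
      if r = keyRank K t then (lab t : ℝ) else 0 := by
  by_cases h : ∃ u ∈ K, keyRank K u = r
  · obtain ⟨u, hu, rfl⟩ := h
    rw [keyDigit_keyRank lab C hu, window_mul_add (hC u)]
    by_cases hut : u = t
    · simp [hut]
    · rw [if_neg hut]
      split_ifs with hr
      · rw [h0, Nat.cast_zero]
        exact fun ht => hut (keyRank_injOn K hu ht hr)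
      · rfl
  · rw [keyDigit, dif_neg h]
    have : window C (((0 : ℕ) : ℝ) - (C + 1) * t) = 0 :=
      window_eq_zero_of_nonpos (by positivity) (by
        have : (0 : ℝ) ≤ (C + 1) * t := by positivity
        simpa using this)
    rw [this]
    split_ifs with hr
    · rw [h0, Nat.cast_zero]
      exact fun ht => h ⟨t, ht, hr.symm⟩
    · rfl

/-- A function supported on at most `s ^ 2` integer keys is evaluated in a number of steps linear
in `s`. -/
theorem exists_memorize {A E B V S : ι} (hEB : E ≠ B) (hEV : E ≠ V) (hBV : B ≠ V) (hSE : S ≠ E)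
    (hSV : S ≠ V) (hSB : S ≠ B) (hAE : A ≠ E) (hAV : A ≠ V) (hAS : A ≠ S)
    {K : Finset ℕ} {lab : ℕ → ℕ} {C b s : ℕ} (hC : ∀ t, lab t ≤ C) (h0 : ∀ t ∉ K, lab t = 0)
    (hb : ∀ t ∈ K, t * (C + 1) + lab t < 2 ^ b) (hs : K.card ≤ s * s) (hs0 : 0 < s) :
    ∃ F, Prog (s + 1 + s * (4 * b + 2)) F ∧ ∀ a : ι → ℝ, (∀ i, 0 ≤ a i) → a B = 0 → a V = 0 →
      a E = 0 → ∀ t : ℕ, a A = t → F a = Function.update a S (a S + lab t) := by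
  have hg : Monotone (fun t => keyRank K t / s) := fun t u h => Nat.div_le_div_right (keyRank_mono K h)
  -- Ranks are cut into blocks of length `s`. The table stores for each block one number whose `s`
  -- digits are the packed keys and labels, so a table of length about `s` covers `s ^ 2` keys.
  obtain ⟨F, hF, hFs⟩ := exists_lookup hAE hg
    (fun j => ∑ i ∈ Finset.range s, keyDigit K lab C (j * s + i) * (2 ^ b) ^ i) s
  obtain ⟨G, hG, hGs⟩ := exists_decode hEB hEV hBV hSE hSV hSB hAE hAV hAS b C s
  refine ⟨_, hF.comp hG, fun a ha hB hV hE t ht => ?_⟩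
  -- The rank equals `K.card` beyond the largest key, so the block number `s` can occur and the
  -- table has `s + 1` entries.
  have hgt : keyRank K t / s ≤ s :=
    Nat.div_le_of_le_mul ((Finset.card_filter_le _ _).trans hs)
  have hF1 := hFs a ha t ht hgt
  have hwin := window_keyDigit hC h0
  have hA1 : F a A = t := by rw [hF1, Function.update_of_ne hAE, ht]
  rw [hGs (F a) (hF.nonneg ha) (by rw [hF1]; simp [hEB.symm, hB]) (by rw [hF1]; simp [hEV.symm, hV])
    (fun i => keyDigit K lab C (keyRank K t / s * s + i)) ?_ (by rw [hF1]; simp) ?_]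
  · have hsum : ∑ i ∈ Finset.range s, window C (keyDigit K lab C (keyRank K t / s * s + i) -
        (C + 1) * F a A) = lab t := by
      rw [hA1]
      simp only [hwin]
      -- Within the fetched block only the digit at the rank of `t` can contribute.
      rw [Finset.sum_eq_single (keyRank K t % s)]
      · rw [if_pos (Nat.div_add_mod' _ _)]
      · intro i _ hi
        rw [if_neg]
        intro h
        have := Nat.div_add_mod' (keyRank K t) s
        lia
      · intro h
        exact absurd (Finset.mem_range.2 (Nat.mod_lt _ hs0)) h
    rw [hsum, hF1]
    funext i
    by_cases h1 : i = S
    · subst h1; simp [hSE]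
    · by_cases h2 : i = E
      · subst h2; simp [h1, hE]
      · simp [h1, h2]
  · intro i
    by_cases h : ∃ u ∈ K, keyRank K u = keyRank K t / s * s + i
    · obtain ⟨u, hu, h⟩ := h
      rw [← h, keyDigit_keyRank lab C hu]
      exact hb u hu
    · rw [keyDigit, dif_neg h]
      positivity
  · intro i
    rw [hA1, hwin]
    split_ifs <;> positivity

/-- The hash of the integers `q 0, …, q (L - 1)`. -/
def hashKey (n L : ℕ) (q : ℕ → ℕ) : ℕ := ∑ k ∈ Finset.range L, (2 ^ n) ^ k * q k

theorem hashKey_lt {n L : ℕ} {q : ℕ → ℕ} (hq : ∀ k < L, q k < 2 ^ n) :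
    hashKey n L q < (2 ^ n) ^ L := by
  have := sum_digits_lt (b := n) (D := fun k => if k < L then q k else 0) (fun k => by
    split_ifs with h
    · exact hq k h
    · positivity) L
  refine lt_of_lt_of_le (Nat.lt_succ_of_le (le_of_eq ?_)) this
  refine Finset.sum_congr rfl fun k hk => ?_
  rw [if_pos (Finset.mem_range.1 hk), mul_comm]

theorem hashKey_inj {n L : ℕ} {q q' : ℕ → ℕ} (hq : ∀ k < L, q k < 2 ^ n)
    (hq' : ∀ k < L, q' k < 2 ^ n) (h : hashKey n L q = hashKey n L q') : ∀ k < L, q k = q' k := by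
  induction L with
  | zero => intro k hk; lia
  | succ L ih =>
    have h1 := hashKey_lt (L := L) fun k hk => hq k (by lia)
    have h2 := hashKey_lt (L := L) fun k hk => hq' k (by lia)
    have e : ∀ q, hashKey n (L + 1) q = hashKey n L q + (2 ^ n) ^ L * q L := fun q =>
      Finset.sum_range_succ _ _
    rw [e, e] at h
    have hp : 0 < (2 ^ n) ^ L := by positivity
    have hL : q L = q' L := by
      have := congrArg (· / (2 ^ n) ^ L) h
      simpa [Nat.add_mul_div_left _ _ hp, Nat.div_eq_of_lt h1, Nat.div_eq_of_lt h2] using this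
    have hrec : hashKey n L q = hashKey n L q' := by rw [hL] at h; lia
    intro k hk
    rcases Nat.lt_succ_iff_lt_or_eq.1 hk with hk | rfl
    · exact ih (fun k hk => hq k (by lia)) (fun k hk => hq' k (by lia)) hrec k hk
    · exact hL

/-- The maximum over `g < G` of labels attached to hashed integer parts. -/
theorem exists_max_labels {X B A E V S O : ι} (hnd : [X, B, A, E, V, S, O].Nodup) (U : ℕ → ι)
    (hU : ∀ k, U k ∉ [X, B, A, E, V, S, O]) {n L G C b s : ℕ} (off : ℕ → ℕ → ℝ) {w : ℝ}
    (hw : 0 < w) {K : ℕ → Finset ℕ} {lab : ℕ → ℕ → ℕ} (hC : ∀ g t, lab g t ≤ C)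
    (h0 : ∀ g, ∀ t ∉ K g, lab g t = 0) (hb : ∀ g, ∀ t ∈ K g, t * (C + 1) + lab g t < 2 ^ b)
    (hs : ∀ g, (K g).card ≤ s * s) (hs0 : 0 < s) :
    ∃ F, Prog (G * (L * (4 * n + 2) + (s + 1 + s * (4 * b + 2)) + 3)) F ∧
      ∀ a : ι → ℝ, (∀ i, 0 ≤ a i) → (∀ i ∈ [X, B, A, E, V, S, O], a i = 0) →
      ∀ (q : ℕ → ℕ → ℕ) (r : ℕ → ℕ → ℝ),
      (∀ g < G, ∀ k < L, q g k < 2 ^ n ∧ 0 ≤ r g k ∧ r g k ≤ 1 - w ∧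
        a (U k) + off g k = q g k + r g k) →
      F a O = ((Finset.range G).sup fun g => lab g (hashKey n L (q g)) : ℕ) := by
  simp only [List.nodup_cons, List.mem_cons, List.not_mem_nil, or_false, not_or, List.nodup_nil,
    and_true, not_false_eq_true, ← ne_eq] at hnd hU
  obtain ⟨⟨hXB, hXA, hXE, hXV, hXS, hXO⟩, ⟨hBA, hBE, hBV, hBS, hBO⟩, ⟨hAE, hAV, hAS, hAO⟩,
    ⟨hEV, hES, hEO⟩, ⟨hVS, hVO⟩, hSO⟩ := hnd
  have hstep : ∀ g : ℕ, ∃ F, Prog (L * (4 * n + 2) + (s + 1 + s * (4 * b + 2)) + 3) F ∧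
      ∀ a : ι → ℝ, (∀ i, 0 ≤ a i) → a X = 0 → a B = 0 → a A = 0 → a E = 0 → a V = 0 → a S = 0 →
      ∀ (q : ℕ → ℕ) (r : ℕ → ℝ), (∀ k < L, q k < 2 ^ n ∧ 0 ≤ r k ∧ r k ≤ 1 - w ∧
        a (U k) + off g k = q k + r k) →
      F a = Function.update a O (max (a O) (lab g (hashKey n L q))) := by
    intro g
    obtain ⟨F, hF, hFs⟩ := exists_hash hXB hXA hBA U (fun k => (hU k).2.2.1)
      (off g) hw n L
    obtain ⟨M, hM, hMs⟩ := exists_memorize hBE.symm hEV hBV hES.symm hVS.symm hBS.symm hAE hAV hAS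
      (hC g) (h0 g) (hb g) (hs g) hs0
    -- `S + max (O - S) 0` is the maximum of `O` and `S`, with one neuron; the other two are
    -- padding.
    have h1 : Shallow (fun a : ι → ℝ => a S + (1 * max (a O - a S) 0 + 0 * max 0 0 + 0 * max 0 0)) :=
      Shallow.of_neurons 1 0 0 (.proj S) ((IsAff.proj O).sub (.proj S)) (.const 0) (.const 0)
    have h2 : Shallow (fun _ : ι → ℝ => (0 : ℝ)) := (IsAff.const 0).shallow
    refine ⟨_, (((hF.comp hM).snoc O h1).snoc A h2).snoc S h2, ?_⟩
    intro a ha hX hB hA hE hV hS q r h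
    have hF1 : F a = Function.update a A (hashKey n L q) := by
      rw [hFs a ha hB hX q r h, hA, zero_add, hashKey, Nat.cast_sum]
    have hM1 := hMs (F a) (hF.nonneg ha) (by rw [hF1]; simp [hBA, hB])
      (by rw [hF1]; simp [hAV.symm, hV]) (by rw [hF1]; simp [hAE.symm, hE]) (hashKey n L q)
      (by rw [hF1]; simp)
    rw [hM1, hF1]
    have hmax : max (lab g (hashKey n L q) + max (a O - lab g (hashKey n L q)) 0) 0 =
        max (a O) (lab g (hashKey n L q)) := by
      have h3 : (0 : ℝ) ≤ lab g (hashKey n L q) := by positivity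
      rcases le_total (a O) (lab g (hashKey n L q)) with h | h
      · rw [max_eq_right (by linarith : a O - lab g (hashKey n L q) ≤ 0), max_eq_right h,
          add_zero, max_eq_left h3]
      · rw [max_eq_left (by linarith : 0 ≤ a O - lab g (hashKey n L q)), max_eq_left h,
          add_sub_cancel, max_eq_left (ha O)]
    funext i
    by_cases i1 : i = S
    · subst i1; simp [hSO, hS]
    · by_cases i2 : i = A
      · subst i2; simp [hAS, hAO, hA]
      · by_cases i3 : i = O
        · subst i3
          simp [hAO.symm, hSO.symm, hAS.symm, hS, hmax]
        · simp [i1, i2, i3]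
  choose F hF hFs using hstep
  refine ⟨Prog.loop F G, Prog.loop_prog hF G, fun a ha hz q r h => ?_⟩
  simp only [List.mem_cons, List.not_mem_nil, or_false, forall_eq_or_imp, forall_eq] at hz
  obtain ⟨hX, hB, hA, hE, hV, hS, hO⟩ := hz
  suffices H : Prog.loop F G a =
      Function.update a O ((Finset.range G).sup fun g => lab g (hashKey n L (q g)) : ℕ) by
    rw [H, Function.update_self]
  induction G with
  | zero => simp [Prog.loop, ← hO]
  | succ G ih =>
    have hi := ih (fun k hk => h k (by lia))
    have hn := (Prog.loop_prog hF G).nonneg ha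
    simp only [Prog.loop]
    rw [hFs G _ hn (by rw [hi]; simp [hXO, hX]) (by rw [hi]; simp [hBO, hB])
      (by rw [hi]; simp [hAO, hA]) (by rw [hi]; simp [hEO, hE]) (by rw [hi]; simp [hVO, hV])
      (by rw [hi]; simp [hSO, hS]) (q G) (r G) ?_, hi]
    · rw [Function.update_idem, Function.update_self, Finset.range_add_one, Finset.sup_insert]
      congr 1
      rw [Nat.cast_max, max_comm]
    · intro k hk
      rw [hi, Function.update_of_ne (hU k).2.2.2.2.2.2]
      exact h G (by lia) k hk

end Memorize

/-! ### Random signs -/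

section Signs

/-- The sign `±1` encoded by a Boolean. -/
def boolSign (b : Bool) : ℝ := if b then 1 else -1

theorem boolSign_sq (b : Bool) : boolSign b ^ 2 = 1 := by cases b <;> simp [boolSign]

/-- The signed sum of the entries of a vector. -/
noncomputable def signSum {D : ℕ} (s : Fin D → Bool) (v : Fin D → ℝ) : ℝ := ∑ j, boolSign (s j) * v j

theorem sum_signs_succ {D : ℕ} (f : (Fin (D + 1) → Bool) → ℝ) :
    ∑ s, f s = ∑ s : Fin D → Bool, (f (Fin.cons true s) + f (Fin.cons false s)) := by
  rw [← (Fin.consEquiv fun _ : Fin (D + 1) => Bool).sum_comp, Fintype.sum_prod_type]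
  simp only [Fintype.univ_bool, Finset.mem_singleton, Bool.true_eq_false, not_false_eq_true,
    Finset.sum_insert, Finset.sum_singleton, ← Finset.sum_add_distrib]
  rfl

theorem signSum_cons {D : ℕ} (b : Bool) (s : Fin D → Bool) (v : Fin (D + 1) → ℝ) :
    signSum (Fin.cons b s) v = boolSign b * v 0 + signSum s (fun j => v j.succ) := by
  simp [signSum, Fin.sum_univ_succ]

theorem sum_signSum_sq {D : ℕ} (v : Fin D → ℝ) :
    ∑ s, signSum s v ^ 2 = 2 ^ D * ∑ j, v j ^ 2 := by
  induction D with
  | zero => simp [signSum]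
  | succ D ih =>
    rw [sum_signs_succ, Fin.sum_univ_succ]
    have : ∀ s : Fin D → Bool, signSum (Fin.cons true s) v ^ 2 + signSum (Fin.cons false s) v ^ 2 =
        2 * v 0 ^ 2 + 2 * signSum s (fun j => v j.succ) ^ 2 := fun s => by
      simp only [signSum_cons, boolSign]; norm_num; ring
    simp only [this, Finset.sum_add_distrib, ← Finset.mul_sum, ih]
    simp [pow_succ]
    ring

/-- Averaging over the first sign gives `v₀ ^ 4 + 6 v₀ ^ 2 X ^ 2 + X ^ 4`. The constant `3` is what
induction preserves, since `3 (v₀ ^ 2 + σ) ^ 2` has the same cross term `6 v₀ ^ 2 σ`. -/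
theorem sum_signSum_pow_four_le {D : ℕ} (v : Fin D → ℝ) :
    ∑ s, signSum s v ^ 4 ≤ 2 ^ D * (3 * (∑ j, v j ^ 2) ^ 2) := by
  induction D with
  | zero => simp [signSum]
  | succ D ih =>
    rw [sum_signs_succ, Fin.sum_univ_succ]
    have : ∀ s : Fin D → Bool, signSum (Fin.cons true s) v ^ 4 + signSum (Fin.cons false s) v ^ 4 =
        2 * v 0 ^ 4 + 12 * v 0 ^ 2 * signSum s (fun j => v j.succ) ^ 2 +
          2 * signSum s (fun j => v j.succ) ^ 4 := fun s => by
      simp only [signSum_cons, boolSign]; norm_num; ring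
    simp only [this, Finset.sum_add_distrib, ← Finset.mul_sum, sum_signSum_sq]
    have h := ih (fun j => v j.succ)
    have h2 : (0 : ℝ) ≤ 2 ^ D * v 0 ^ 4 := by positivity
    simp only [Finset.sum_const, Finset.card_univ, Fintype.card_fun, Fintype.card_bool,
      Fintype.card_fin, nsmul_eq_mul, pow_succ (2 : ℝ) D]
    push_cast
    nlinarith

/-- A second moment method: a nonnegative function with mean `m` and mean square at most `3 m ^ 2`
is at least `9 / 25 * m` on a fraction `1 / 8` of the points. -/
theorem card_filter_ge_of_moments {Ω : Type*} [Fintype Ω] {Z : Ω → ℝ} {m : ℝ}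
    (hm : 0 ≤ m) (h1 : ∑ s, Z s = Fintype.card Ω * m)
    (h2 : ∑ s, Z s ^ 2 ≤ Fintype.card Ω * (3 * m ^ 2)) :
    (1 / 8 : ℝ) * Fintype.card Ω ≤ ((Finset.univ.filter fun s => 9 / 25 * m ≤ Z s).card : ℝ) := by
  classical
  set W := Finset.univ.filter fun s => 9 / 25 * m ≤ Z s with hW
  -- The case `m = 0` is separate because the argument below cancels `m ^ 2`.
  rcases hm.eq_or_lt with rfl | hm
  · have : ∑ s, Z s ^ 2 = 0 := le_antisymm (by simpa using h2) (Finset.sum_nonneg fun _ _ => sq_nonneg _)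
    have hz : ∀ s, Z s = 0 := fun s => by
      have := (Finset.sum_eq_zero_iff_of_nonneg (fun s _ => sq_nonneg (Z s))).1 this s (Finset.mem_univ s)
      simpa using this
    have : W = Finset.univ := by
      rw [hW]; ext s; simp [hz]
    rw [this, Finset.card_univ]
    have : (0 : ℝ) ≤ Fintype.card Ω := by positivity
    linarith
  set n : ℝ := (Fintype.card Ω : ℝ) with hn
  have hn0 : 0 ≤ n := by positivity
  have hsplit : ∑ s, Z s = ∑ s ∈ W, Z s + ∑ s ∈ Wᶜ, Z s := (Finset.sum_add_sum_compl W _).symm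
  have hcompl : ∑ s ∈ Wᶜ, Z s ≤ n * (9 / 25 * m) := by
    calc ∑ s ∈ Wᶜ, Z s ≤ ∑ s ∈ Wᶜ, (9 / 25 * m) := Finset.sum_le_sum fun s hs => by
          simp only [hW, Finset.mem_compl, Finset.mem_filter, Finset.mem_univ, true_and, not_le] at hs
          exact hs.le
      _ = (Wᶜ).card * (9 / 25 * m) := by simp
      _ ≤ n * (9 / 25 * m) := by
          gcongr
          rw [hn]
          exact_mod_cast Finset.card_le_univ _
  -- Points below the threshold carry at most `9 / 25` of the mass. Cauchy–Schwarz on the rest gives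
  -- the fraction `(16 / 25) ^ 2 / 3`, which exceeds `1 / 8`.
  have hlow : n * (16 / 25 * m) ≤ ∑ s ∈ W, Z s := by nlinarith
  have hcs : (∑ s ∈ W, Z s) ^ 2 ≤ W.card * ∑ s ∈ W, Z s ^ 2 := sq_sum_le_card_mul_sum_sq
  have hsub : ∑ s ∈ W, Z s ^ 2 ≤ ∑ s, Z s ^ 2 :=
    Finset.sum_le_sum_of_subset_of_nonneg (Finset.subset_univ _) fun _ _ _ => sq_nonneg _
  have h3 : (n * (16 / 25 * m)) ^ 2 ≤ (W.card : ℝ) * (n * (3 * m ^ 2)) := by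
    calc (n * (16 / 25 * m)) ^ 2 ≤ (∑ s ∈ W, Z s) ^ 2 := by gcongr
      _ ≤ W.card * ∑ s ∈ W, Z s ^ 2 := hcs
      _ ≤ (W.card : ℝ) * (n * (3 * m ^ 2)) := by gcongr; exact hsub.trans h2
  rcases hn0.eq_or_lt with h0 | h0
  · rw [← h0]; simp
  · have h4 : n * m ^ 2 * (n * (256 / 625)) ≤ n * m ^ 2 * (W.card * 3) := by
      linarith
    have := le_of_mul_le_mul_left h4 (by positivity)
    linarith

/-- Bucketed signed sums of a vector have, in total, a large square for many choices of signs. -/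
theorem card_filter_bucket_signSum {D m : ℕ} (bk : Fin D → Fin m) (v : Fin D → ℝ) :
    (1 / 8 : ℝ) * Fintype.card (Fin D → Bool) ≤
      ((Finset.univ.filter fun s : Fin D → Bool => 9 / 25 * ∑ j, v j ^ 2 ≤
        ∑ k, signSum s (fun j => if bk j = k then v j else 0) ^ 2).card : ℝ) := by
  have hv : ∑ k, ∑ j, (if bk j = k then v j else 0) ^ 2 = ∑ j, v j ^ 2 := by
    rw [Finset.sum_comm]
    refine Finset.sum_congr rfl fun j _ => ?_
    simp [ite_pow]
  have hcard : (Fintype.card (Fin D → Bool) : ℝ) = 2 ^ D := by simp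
  refine card_filter_ge_of_moments (Finset.sum_nonneg fun _ _ => sq_nonneg _) ?_ ?_
  · rw [Finset.sum_comm, hcard, ← hv, Finset.mul_sum]
    exact Finset.sum_congr rfl fun k _ => sum_signSum_sq _
  · set σ : Fin m → ℝ := fun k => ∑ j, (if bk j = k then v j else 0) ^ 2 with hσ
    have hσ0 : ∀ k, 0 ≤ σ k := fun k => Finset.sum_nonneg fun _ _ => sq_nonneg _
    set X : Fin m → (Fin D → Bool) → ℝ := fun k s =>
      signSum s (fun j => if bk j = k then v j else 0) with hX
    have h4 : ∀ k, ∑ s, X k s ^ 4 ≤ 2 ^ D * (3 * σ k ^ 2) := fun k => sum_signSum_pow_four_le _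
    -- Cauchy–Schwarz reduces mixed moments to fourth moments, so independence of the buckets is not
    -- used.
    have hmix : ∀ k l, ∑ s, X k s ^ 2 * X l s ^ 2 ≤ 2 ^ D * (3 * (σ k * σ l)) := by
      intro k l
      have hcs := Finset.sum_mul_sq_le_sq_mul_sq Finset.univ (fun s => X k s ^ 2) (fun s => X l s ^ 2)
      have e : ∀ k, ∑ s, (X k s ^ 2) ^ 2 = ∑ s, X k s ^ 4 := fun k =>
        Finset.sum_congr rfl fun s _ => by ring
      rw [e, e] at hcs
      refine le_of_sq_le_sq (hcs.trans ?_) (by have := hσ0 k; have := hσ0 l; positivity)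
      calc (∑ s, X k s ^ 4) * ∑ s, X l s ^ 4
          ≤ (2 ^ D * (3 * σ k ^ 2)) * (2 ^ D * (3 * σ l ^ 2)) := by
            gcongr
            · exact h4 k
            · exact h4 l
        _ = _ := by ring
    calc ∑ s, (∑ k, X k s ^ 2) ^ 2 = ∑ k, ∑ l, ∑ s, X k s ^ 2 * X l s ^ 2 := by
          simp only [sq (∑ k, _), Finset.sum_mul_sum]
          rw [Finset.sum_comm]
          exact Finset.sum_congr rfl fun k _ => Finset.sum_comm
      _ ≤ ∑ k, ∑ l, 2 ^ D * (3 * (σ k * σ l)) :=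
          Finset.sum_le_sum fun k _ => Finset.sum_le_sum fun l _ => hmix k l
      _ = Fintype.card (Fin D → Bool) * (3 * (∑ j, v j ^ 2) ^ 2) := by
          rw [hcard, ← hv, sq (∑ k, _), Finset.sum_mul_sum]
          rw [Finset.mul_sum, Finset.mul_sum]
          refine Finset.sum_congr rfl fun k _ => ?_
          rw [Finset.mul_sum, Finset.mul_sum]

/-- Greedy covering: if each test is passed by a fraction `1 / 8` of the candidates, then few
candidates suffice to pass all tests. -/
theorem exists_cover {Ω τ : Type*} [Fintype Ω] [Nonempty Ω] (M : Finset τ) (good : τ → Ω → Prop)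
    (hgood : ∀ t ∈ M, open Classical in
      (1 / 8 : ℝ) * Fintype.card Ω ≤ ((Finset.univ.filter fun s => good t s).card : ℝ)) {L : ℕ}
    (hL : (M.card : ℝ) * (7 / 8) ^ L < 1) :
    ∃ ω : Fin L → Ω, ∀ t ∈ M, ∃ l, good t (ω l) := by
  classical
  have key : ∀ L : ℕ, ∃ ω : Fin L → Ω,
      ((M.filter fun t => ∀ l, ¬ good t (ω l)).card : ℝ) ≤ M.card * (7 / 8) ^ L := by
    intro L
    induction L with
    | zero => exact ⟨Fin.elim0, by simp⟩
    | succ L ih =>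
      obtain ⟨ω, hω⟩ := ih
      set Q := M.filter fun t => ∀ l, ¬ good t (ω l) with hQ
      -- Double counting over the tests not yet passed: some candidate passes an eighth of them, and
      -- `7 / 8` remain.
      have hdc : (1 / 8 : ℝ) * Fintype.card Ω * Q.card ≤
          ∑ s : Ω, ((Q.filter fun t => good t s).card : ℝ) := by
        have : ∑ s : Ω, ((Q.filter fun t => good t s).card : ℝ) =
            ∑ t ∈ Q, ((Finset.univ.filter fun s => good t s).card : ℝ) := by
          simp only [Finset.card_filter, Nat.cast_sum]
          exact Finset.sum_comm
        rw [this]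
        calc (1 / 8 : ℝ) * Fintype.card Ω * Q.card = ∑ t ∈ Q, (1 / 8 : ℝ) * Fintype.card Ω := by
              simp; ring
          _ ≤ _ := Finset.sum_le_sum fun t ht => by
              convert hgood t (Finset.mem_filter.1 ht).1
      obtain ⟨s, hs⟩ : ∃ s : Ω, (1 / 8 : ℝ) * Q.card ≤ ((Q.filter fun t => good t s).card : ℝ) := by
        by_contra hcon
        push Not at hcon
        have := Finset.sum_lt_sum_of_nonempty (Finset.univ_nonempty (α := Ω)) fun s _ => hcon s
        simp only [Finset.sum_const, Finset.card_univ, nsmul_eq_mul] at this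
        linarith
      refine ⟨Fin.cons s ω, ?_⟩
      have hsub : (M.filter fun t => ∀ l, ¬ good t ((Fin.cons s ω : Fin (L + 1) → Ω) l)) =
          Q.filter fun t => ¬ good t s := by
        ext t
        simp only [hQ, Finset.mem_filter, Fin.forall_fin_succ, Fin.cons_zero, Fin.cons_succ]
        tauto
      rw [hsub]
      have hadd : ((Q.filter fun t => good t s).card : ℝ) + (Q.filter fun t => ¬ good t s).card =
          Q.card := by
        exact_mod_cast Finset.card_filter_add_card_filter_not (s := Q) (fun t => good t s)
      rw [pow_succ]
      linarith
  obtain ⟨ω, hω⟩ := key L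
  refine ⟨ω, fun t ht => ?_⟩
  by_contra hcon
  push Not at hcon
  have : 1 ≤ (M.filter fun t => ∀ l, ¬ good t (ω l)).card :=
    Finset.card_pos.2 ⟨t, Finset.mem_filter.2 ⟨ht, hcon⟩⟩
  have : (1 : ℝ) ≤ (M.filter fun t => ∀ l, ¬ good t (ω l)).card := by exact_mod_cast this
  linarith

/-- The number of sign vectors used for `N` data points. -/
noncomputable def signCount (N : ℕ) : ℕ := ⌊16 * Real.log N⌋₊ + 1

/-- From `7 / 8 ≤ exp (-1 / 8)`: more than `16 log N` factors beat the `N ^ 2` pairs of points. -/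
theorem sq_mul_pow_signCount_lt_one {N : ℕ} (hN : 0 < N) :
    ((N : ℝ) * N) * (7 / 8) ^ signCount N < 1 := by
  have h0 : (0 : ℝ) < N := by exact_mod_cast hN
  have h1 : 16 * Real.log N < signCount N := by
    rw [signCount]; push_cast; exact Nat.lt_floor_add_one _
  have h2 : (7 / 8 : ℝ) ^ signCount N ≤ Real.exp (-(1 / 8) * signCount N) := by
    rw [mul_comm, Real.exp_nat_mul]
    gcongr
    have := Real.add_one_le_exp (-(1 / 8 : ℝ))
    linarith
  have h3 : Real.exp (-(1 / 8) * signCount N) < Real.exp (-(2 * Real.log N)) := by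
    apply Real.exp_lt_exp.2; linarith
  have h4 : (N : ℝ) * N * Real.exp (-(2 * Real.log N)) = 1 := by
    rw [Real.exp_neg, two_mul, Real.exp_add, Real.exp_log h0]
    field_simp
  calc _ < (N : ℝ) * N * Real.exp (-(2 * Real.log N)) := by
        gcongr; exact h2.trans_lt h3
    _ = 1 := h4

/-- Few bucketed sign sketches detect all differences of `N` points. -/
theorem exists_signs {N D m : ℕ} (hN : 0 < N) (bk : Fin D → Fin m) (x : Fin N → Fin D → ℝ) :
    ∃ s : Fin (signCount N) → Fin D → Bool, ∀ i j, ∃ l,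
      9 / 25 * ∑ t, (x i t - x j t) ^ 2 ≤
        ∑ k, signSum (s l) (fun t => if bk t = k then x i t - x j t else 0) ^ 2 := by
  classical
  obtain ⟨ω, hω⟩ := exists_cover (Finset.univ : Finset (Fin N × Fin N))
    (fun (p : Fin N × Fin N) (s : Fin D → Bool) => 9 / 25 * ∑ t, (x p.1 t - x p.2 t) ^ 2 ≤
        ∑ k, signSum s (fun t => if bk t = k then x p.1 t - x p.2 t else 0) ^ 2)
    (fun p _ => by
      convert card_filter_bucket_signSum bk (fun t => x p.1 t - x p.2 t)) (L := signCount N)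
    (by simpa using sq_mul_pow_signCount_lt_one hN)
  exact ⟨ω, fun i j => hω (i, j) (Finset.mem_univ _)⟩

theorem signSum_sq_le {D : ℕ} (s : Fin D → Bool) (v : Fin D → ℝ) :
    signSum s v ^ 2 ≤ D * ∑ j, v j ^ 2 := by
  have := Finset.sum_mul_sq_le_sq_mul_sq Finset.univ (fun j => boolSign (s j)) v
  simpa [boolSign_sq, signSum] using this

theorem signSum_sub {D : ℕ} (s : Fin D → Bool) (v w : Fin D → ℝ) :
    signSum s v - signSum s w = signSum s (fun j => v j - w j) := by
  simp [signSum, mul_sub]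

end Signs

/-! ### Memorization through randomly projected grid cells -/

section Cells

/-- Finitely many reals can be shifted away from the integers. -/
theorem exists_offset {κ : Type*} (I : Finset κ) (α : κ → ℝ) {n : ℕ} (hI : I.card ≤ n) :
    ∃ o : ℝ, 0 ≤ o ∧ o ≤ 1 ∧ ∀ i ∈ I, 1 / (2 * ((n : ℝ) + 1)) ≤ Int.fract (α i + o) ∧
      Int.fract (α i + o) ≤ 1 - 1 / (2 * ((n : ℝ) + 1)) := by
  classical
  -- Pigeonhole: of `n + 1` equal subintervals of `[0, 1)`, one contains no fractional part.
  have hlt : (I.image fun i => ⌊Int.fract (α i) * (n + 1)⌋₊).card < (Finset.range (n + 1)).card := by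
    rw [Finset.card_range]
    exact Nat.lt_succ_of_le (Finset.card_image_le.trans hI)
  obtain ⟨j, hj, hj'⟩ := Finset.exists_mem_notMem_of_card_lt_card hlt
  have hn : (0 : ℝ) < n + 1 := by positivity
  have hjn : (j : ℝ) ≤ n := by exact_mod_cast Nat.lt_succ_iff.1 (Finset.mem_range.1 hj)
  set h : ℝ := 1 / (2 * ((n : ℝ) + 1)) with hh
  have hh0 : 0 < h := by positivity
  have hinv : 2 * h * (n + 1) = 1 := by rw [hh]; field_simp
  set c : ℝ := (2 * j + 1) * h with hc
  have hc1 : c ≤ 1 - h := by nlinarith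
  have hc0 : h ≤ c := by rw [hc]; nlinarith [(by positivity : (0 : ℝ) ≤ j)]
  -- `c` is the midpoint of the free subinterval and `h` half its length; the shift moves `c` to an
  -- integer.
  refine ⟨1 - c, by linarith, by linarith, fun i hi => ?_⟩
  have hf0 := Int.fract_nonneg (α i)
  have hf1 := Int.fract_lt_one (α i)
  have hne : ⌊Int.fract (α i) * (n + 1)⌋₊ ≠ j := fun he =>
    hj' (Finset.mem_image.2 ⟨i, hi, he⟩)
  rcases lt_or_gt_of_ne hne with hlt | hgt
  · have h1 : Int.fract (α i) * (n + 1) < j := (Nat.floor_lt' (by lia)).1 hlt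
    have h2 : Int.fract (α i) ≤ 2 * j * h := by nlinarith
    have : Int.fract (α i + (1 - c)) = Int.fract (α i) + 1 - c := by
      rw [Int.fract_eq_iff]
      refine ⟨by linarith, by linarith, ⌊α i⌋, ?_⟩
      have := Int.self_sub_fract (α i)
      linarith
    rw [this]
    constructor <;> linarith
  · have h1 : (j : ℝ) + 1 ≤ Int.fract (α i) * (n + 1) := by
      have := (Nat.le_floor_iff (by positivity)).1 (Nat.succ_le_of_lt hgt)
      exact_mod_cast this
    have h2 : 2 * (j + 1) * h ≤ Int.fract (α i) := by nlinarith
    have : Int.fract (α i + (1 - c)) = Int.fract (α i) - c := by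
      rw [Int.fract_eq_iff]
      refine ⟨by linarith, by linarith, ⌊α i⌋ + 1, ?_⟩
      have := Int.self_sub_fract (α i)
      push_cast
      linarith
    rw [this]
    constructor <;> linarith

theorem IsAff.signSum {d : ℕ} (s : Fin d → Bool) : IsAff (signSum s) :=
  IsAff.sum _ fun j => (IsAff.proj j).const_mul _

theorem abs_signSum_le {d : ℕ} (s : Fin d → Bool) {v : Fin d → ℝ} {r : ℝ} (hr : 0 ≤ r)
    (hv : ∑ j, v j ^ 2 ≤ r ^ 2) : |signSum s v| ≤ √d * r := by
  refine abs_le_of_sq_le_sq ?_ (by positivity)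
  rw [mul_pow, Real.sq_sqrt (by positivity)]
  exact (signSum_sq_le s v).trans (by gcongr)

/-- A network that reads off the labels from the cells of randomly projected grids, one shifted
grid for each of `G` groups of at most `n` points. It is correct outside of the thin zones
`1 - δ < fract (u g k z)`, which are also avoided by the balls around the points of group `g`. -/
theorem exists_cell_net {d N C G n s nb cb : ℕ} {x : Fin N → Fin d → ℝ} {y : Fin N → ℕ}
    {ε R r : ℝ} (hN : 0 < N) (hε : 0 < ε) (hr : 0 ≤ r) (hR : 0 ≤ R) (hrε : r ≤ ε)
    (hy : ∀ i, y i ≤ C) (hsep : ∀ i j, y i ≠ y j → 4 * ε ^ 2 ≤ ∑ t, (x i t - x j t) ^ 2)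
    (hxR : ∀ i, ∑ t, x i t ^ 2 ≤ R ^ 2) (hn : 0 < n) (hnr : 5 * n * √d * r ≤ ε)
    (grp : Fin N → ℕ) (hgrp : ∀ i, grp i < G)
    (hfib : ∀ g, (Finset.univ.filter fun i => grp i = g).card ≤ n)
    (hs : n ≤ s * s) (hs0 : 0 < s) (hnb : 2 * (√d * (R + ε) / ε) + 1 < 2 ^ nb)
    (hcb : C + 1 ≤ 2 ^ cb) :
    ∃ u : ℕ → ℕ → (Fin d → ℝ) → ℝ, (∀ g k, IsAff (u g k)) ∧
      (∀ i z, ∑ t, (z t - x i t) ^ 2 ≤ r ^ 2 → ∀ k,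
        Int.fract (u (grp i) k z) ≤ 1 - (1 / (2 * ((n : ℝ) + 1)) - 1 / (5 * n))) ∧
      ∀ δ : ℝ, 0 < δ → ∃ net : ReLUNet d,
        net.numParams ≤ (d + 2) * (signCount N + 9) +
          2 * (G * (signCount N * (4 * nb + 2) +
            (s + 1 + s * (4 * (nb * signCount N + cb) + 2)) + 3)) * (signCount N + 12) ^ 2 ∧
        ∀ i z, ∑ t, (z t - x i t) ^ 2 ≤ r ^ 2 →
          (∀ g < G, ∀ k < signCount N, Int.fract (u g k z) ≤ 1 - δ) → net.eval z = y i := by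
  classical
  obtain ⟨s₀, hs₀⟩ := exists_signs hN (fun _ : Fin d => (0 : Fin 1)) x
  generalize signCount N = L at s₀ hs₀ ⊢
  set Sh := √d * (R + ε) / ε with hSh
  let sg : ℕ → Fin d → Bool := fun k => if h : k < L then s₀ ⟨k, h⟩ else fun _ => true
  -- Grid cells get unit length after scaling by `ε⁻¹`; the shift `Sh` makes the projections
  -- nonnegative on all balls, as registers require.
  let w : ℕ → (Fin d → ℝ) → ℝ := fun k z => ε⁻¹ * signSum (sg k) z + Sh
  have hw : ∀ k, IsAff (w k) := fun k => ((IsAff.signSum _).const_mul _).add (.const _)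
  have hdiff : ∀ k z z', w k z - w k z' = ε⁻¹ * signSum (sg k) (fun j => z j - z' j) := by
    intro k z z'
    simp only [w]
    rw [← signSum_sub]
    ring
  have hn' : (0 : ℝ) < n := by exact_mod_cast hn
  have hclose : ∀ i z, ∑ t, (z t - x i t) ^ 2 ≤ r ^ 2 → ∀ k, |w k z - w k (x i)| ≤ 1 / (5 * n) := by
    intro i z hz k
    rw [hdiff, abs_mul, abs_of_pos (inv_pos.2 hε)]
    have := abs_signSum_le (sg k) hr hz
    rw [inv_mul_le_iff₀ hε, mul_one_div, le_div_iff₀ (by positivity)]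
    nlinarith
  have hrange : ∀ i z, ∑ t, (z t - x i t) ^ 2 ≤ r ^ 2 → ∀ k, 0 ≤ w k z ∧ w k z ≤ 2 * Sh := by
    intro i z hz k
    have h1 := abs_signSum_le (sg k) hr hz
    have h2 := abs_signSum_le (sg k) hR (hxR i)
    have h3 : signSum (sg k) z = signSum (sg k) (fun j => z j - x i j) + signSum (sg k) (x i) := by
      rw [← signSum_sub]; ring
    have h4 : |signSum (sg k) z| ≤ √d * (R + ε) := by
      rw [h3]
      refine (abs_add_le _ _).trans ?_
      have : √(d : ℝ) * r ≤ √d * ε := by gcongr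
      linarith
    have h5 : |ε⁻¹ * signSum (sg k) z| ≤ Sh := by
      rw [abs_mul, abs_of_pos (inv_pos.2 hε), hSh, inv_mul_eq_div]
      gcongr
    have := abs_le.1 h5
    simp only [w]
    constructor <;> linarith
  have hself : ∀ i, ∑ t, (x i t - x i t) ^ 2 ≤ r ^ 2 := fun i => by simp [sq_nonneg]
  have hfar : ∀ i j, y i ≠ y j → ∃ k < L, 6 / 5 ≤ |w k (x i) - w k (x j)| := by
    intro i j hij
    obtain ⟨l, hl⟩ := hs₀ i j
    refine ⟨l, l.2, ?_⟩
    rw [hdiff, abs_mul, abs_of_pos (inv_pos.2 hε), inv_mul_eq_div, le_div_iff₀ hε]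
    have hsl : sg l = s₀ l := dif_pos l.2
    rw [hsl]
    have h1 := hsep i j hij
    have h2 : (6 / 5 * ε) ^ 2 ≤ signSum (s₀ l) (fun t => x i t - x j t) ^ 2 := by
      simp only [Finset.univ_unique, Fin.default_eq_zero, Finset.sum_singleton, if_true] at hl
      refine le_trans ?_ hl
      nlinarith
    have := sq_le_sq.1 h2
    rwa [abs_of_pos (by positivity : 0 < 6 / 5 * ε)] at this
  have hoff : ∀ g k : ℕ, ∃ o : ℝ, 0 ≤ o ∧ o ≤ 1 ∧ ∀ i ∈ Finset.univ.filter (fun i => grp i = g),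
      1 / (2 * ((n : ℝ) + 1)) ≤ Int.fract (w k (x i) + o) ∧
      Int.fract (w k (x i) + o) ≤ 1 - 1 / (2 * ((n : ℝ) + 1)) := fun g k =>
    exists_offset _ (fun i => w k (x i)) (hfib g)
  choose off hoff0 hoff1 hoff2 using hoff
  let u : ℕ → ℕ → (Fin d → ℝ) → ℝ := fun g k z => w k z + off g k
  -- The shifted centres keep a distance from the integers that exceeds the variation of a
  -- projection over a ball, so each ball stays inside one cell of its own grid.
  have hμ : 1 / (5 * (n : ℝ)) < 1 / (2 * ((n : ℝ) + 1)) := by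
    have : (1 : ℝ) ≤ n := by exact_mod_cast hn
    apply one_div_lt_one_div_of_lt <;> linarith
  have hown : ∀ i z, ∑ t, (z t - x i t) ^ 2 ≤ r ^ 2 → ∀ k, ⌊u (grp i) k z⌋ = ⌊u (grp i) k (x i)⌋ ∧
      Int.fract (u (grp i) k z) ≤ 1 - (1 / (2 * ((n : ℝ) + 1)) - 1 / (5 * n)) := by
    intro i z hz k
    have h1 := abs_le.1 (hclose i z hz k)
    obtain ⟨h2, h3⟩ := hoff2 (grp i) k i (by simp)
    have h4 : Int.fract (u (grp i) k (x i)) = u (grp i) k (x i) - ⌊u (grp i) k (x i)⌋ := rfl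
    simp only [u] at h4 ⊢
    have hfl : ⌊w k z + off (grp i) k⌋ = ⌊w k (x i) + off (grp i) k⌋ := by
      rw [Int.floor_eq_iff]
      constructor <;> linarith
    refine ⟨hfl, ?_⟩
    have h5 : Int.fract (w k z + off (grp i) k) =
        w k z + off (grp i) k - ⌊w k z + off (grp i) k⌋ := rfl
    rw [h5, hfl]
    linarith
  refine ⟨u, fun g k => (hw k).add (.const _), fun i z hz k => (hown i z hz k).2, fun δ hδ => ?_⟩
  let q : ℕ → (Fin d → ℝ) → ℕ → ℕ := fun g z k => ⌊u g k z⌋₊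
  have hq : ∀ i z, ∑ t, (z t - x i t) ^ 2 ≤ r ^ 2 → ∀ g k, q g z k < 2 ^ nb := by
    intro i z hz g k
    obtain ⟨h1, h2⟩ := hrange i z hz k
    have h3 := hoff0 g k
    have h4 := hoff1 g k
    refine (Nat.floor_lt (by positivity)).2 ?_
    push_cast
    simp only [u]
    linarith
  have hu0 : ∀ i z, ∑ t, (z t - x i t) ^ 2 ≤ r ^ 2 → ∀ g k, 0 ≤ u g k z := fun i z hz g k =>
    add_nonneg (hrange i z hz k).1 (hoff0 g k)
  have hfloor : ∀ i z, ∑ t, (z t - x i t) ^ 2 ≤ r ^ 2 → ∀ g k,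
      u g k z = q g z k + Int.fract (u g k z) := by
    intro i z hz g k
    have h1 : ((q g z k : ℕ) : ℝ) = (⌊u g k z⌋ : ℝ) := by
      simp only [q]
      rw [natCast_floor_eq_intCast_floor (hu0 i z hz g k)]
    rw [h1, Int.floor_add_fract]
  -- An empty cell receives `0`, which is neutral for the maximum over the groups.
  let lab : ℕ → ℕ → ℕ := fun g t =>
    if h : ∃ i, grp i = g ∧ t = hashKey nb L (q g (x i)) then y h.choose else 0
  let K : ℕ → Finset ℕ := fun g =>
    (Finset.univ.filter fun i => grp i = g).image fun i => hashKey nb L (q g (x i))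
  have hlabC : ∀ g t, lab g t ≤ C := by
    intro g t
    simp only [lab]
    split_ifs
    · exact hy _
    · exact Nat.zero_le _
  have hlab0 : ∀ g, ∀ t ∉ K g, lab g t = 0 := by
    intro g t ht
    simp only [lab]
    rw [dif_neg]
    rintro ⟨i, hi, rfl⟩
    exact ht (Finset.mem_image.2 ⟨i, by simp [hi], rfl⟩)
  have hb : ∀ g, ∀ t ∈ K g, t * (C + 1) + lab g t < 2 ^ (nb * L + cb) := by
    intro g t ht
    obtain ⟨i, _, rfl⟩ := Finset.mem_image.1 ht
    have h1 : hashKey nb L (q g (x i)) < (2 ^ nb) ^ L :=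
      hashKey_lt fun k _ => hq i (x i) (hself i) g k
    have h2 := hlabC g (hashKey nb L (q g (x i)))
    rw [pow_add, pow_mul]
    calc _ < (hashKey nb L (q g (x i)) + 1) * (C + 1) := by nlinarith
      _ ≤ _ := Nat.mul_le_mul h1 hcb
  have hKs : ∀ g, (K g).card ≤ s * s := fun g => (Finset.card_image_le.trans (hfib g)).trans hs
  -- Indices from `L` on point to a spare register that is never written.
  let U : ℕ → Fin L ⊕ Fin 8 := fun k => if h : k < L then Sum.inl ⟨k, h⟩ else Sum.inr 7
  obtain ⟨F, hF, hFs⟩ := exists_max_labels (ι := Fin L ⊕ Fin 8) (X := Sum.inr 0) (B := Sum.inr 1)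
    (A := Sum.inr 2) (E := Sum.inr 3) (V := Sum.inr 4) (S := Sum.inr 5) (O := Sum.inr 6)
    (by simp) U (fun k => by simp only [U]; split_ifs <;> simp) (n := nb) (L := L) (G := G)
    off hδ hlabC hlab0 hb hKs hs0
  obtain ⟨net, hnet, hev⟩ := hF.exists_reluNet (A := Sum.elim (fun k => w k) (fun _ _ => 0))
    (by rintro (k | k); exacts [hw k, IsAff.const 0]) (Sum.inr 6)
  refine ⟨net, ?_, fun i z hz hgood => ?_⟩
  · simpa [add_assoc] using hnet
  -- Sharing a cell forces every projection of `z` and `x j` to differ by less than `1`; for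
  -- different labels some projection differs by at least `6 / 5 - 1 / 5`.
  have hcell : ∀ g j, hashKey nb L (q g z) = hashKey nb L (q g (x j)) → y j = y i := by
    intro g j hj
    by_contra hne
    obtain ⟨k, hk, h1⟩ := hfar j i hne
    have h2 := hashKey_inj (fun k _ => hq i z hz g k) (fun k _ => hq j (x j) (hself j) g k) hj k hk
    have h3 := hfloor i z hz g k
    have h4 := hfloor j (x j) (hself j) g k
    rw [h2] at h3
    have h5 := Int.fract_nonneg (u g k z)
    have h6 := Int.fract_lt_one (u g k z)
    have h7 := Int.fract_nonneg (u g k (x j))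
    have h8 := Int.fract_lt_one (u g k (x j))
    have h9 := abs_le.1 (hclose i z hz k)
    have h10 : 1 / (5 * (n : ℝ)) ≤ 1 / 5 := by
      have : (1 : ℝ) ≤ n := by exact_mod_cast hn
      apply one_div_le_one_div_of_le <;> linarith
    have h11 : w k z - w k (x j) = u g k z - u g k (x j) := by simp only [u]; ring
    rcases abs_cases (w k (x j) - w k (x i)) with ⟨h, _⟩ | ⟨h, _⟩ <;> linarith
  have hlab_le : ∀ g, lab g (hashKey nb L (q g z)) ≤ y i := by
    intro g
    simp only [lab]
    split_ifs with h
    · exact (hcell g _ h.choose_spec.2).le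
    · exact Nat.zero_le _
  have hlab_eq : lab (grp i) (hashKey nb L (q (grp i) z)) = y i := by
    have h : ∃ j, grp j = grp i ∧ hashKey nb L (q (grp i) z) = hashKey nb L (q (grp i) (x j)) := by
      refine ⟨i, rfl, ?_⟩
      congr 1
      ext k
      simp only [q]
      rw [← Int.floor_toNat, ← Int.floor_toNat, (hown i z hz k).1]
    simp only [lab]
    rw [dif_pos h]
    exact hcell _ _ h.choose_spec.2
  rw [hev, hFs _ (fun i => le_max_right _ _) (by simp) (fun g => q g z)
    (fun g k => Int.fract (u g k z))]
  · congr 1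
    refine le_antisymm (Finset.sup_le fun g _ => hlab_le g) ?_
    conv_lhs => rw [← hlab_eq]
    exact Finset.le_sup (f := fun g => lab g (hashKey nb L (q g z))) (Finset.mem_range.2 (hgrp i))
  · intro g hg k hk
    refine ⟨hq i z hz g k, Int.fract_nonneg _, hgood g hg k hk, ?_⟩
    rw [← hfloor i z hz g k]
    simp [U, hk, u, max_eq_left (hrange i z hz k).1]

end Cells

/-! ### Memorization through distances -/

section Balls

variable {ι : Type*} [Fintype ι] [DecidableEq ι]

/-- Halving steps for the square function: `x - x ^ 2` is removed from the register `S`, up to an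
error of order `4 ^ (-l)`. -/
theorem exists_square {X S : ι} (hXS : X ≠ S) (l : ℕ) :
    ∃ F, Prog (l * 2) F ∧ ∀ a : ι → ℝ, (∀ i, 0 ≤ a i) → a X ≤ 1 → 0 ≤ a S - (a X - a X ^ 2) →
      ∃ x', 0 ≤ x' ∧ x' ≤ 1 ∧ F a = Function.update (Function.update a X x') S
        (a S - (a X - a X ^ 2) + (x' - x' ^ 2) / 4 ^ l) := by
  induction l with
  | zero =>
    refine ⟨_, by simpa using Prog.nil, fun a ha h1 _ => ⟨a X, ha X, h1, ?_⟩⟩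
    simp
  | succ l ih =>
    obtain ⟨F, hF, hFs⟩ := ih
    have h1 : Shallow (fun a : ι → ℝ =>
        2 * a X + (-4 * max (a X - 1 / 2) 0 + 0 * max 0 0 + 0 * max 0 0)) :=
      Shallow.of_neurons _ _ _ ((IsAff.proj X).const_mul 2) ((IsAff.proj X).sub (.const _))
        (.const 0) (.const 0)
    have h2 : Shallow (fun a : ι → ℝ => a S - 1 / 4 ^ (l + 1) * a X) :=
      ((IsAff.proj S).sub ((IsAff.proj X).const_mul _)).shallow
    refine ⟨_, by rw [add_mul]; exact (hF.snoc X h1).snoc S h2, fun a ha hX hS => ?_⟩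
    obtain ⟨x, hx0, hx1, hFa⟩ := hFs a ha hX hS
    have hXa : F a X = x := by rw [hFa]; simp [hXS]
    have hSa : F a S = a S - (a X - a X ^ 2) + (x - x ^ 2) / 4 ^ l := by rw [hFa]; simp
    -- With `x'` the tent map of `x`, the identity `x - x ^ 2 = x' / 4 + (x' - x' ^ 2) / 4`
    -- telescopes, and the remainder shrinks by `4` at each step.
    obtain ⟨x', hx', h0, h1, hrec⟩ : ∃ x', 2 * x + -4 * max (x - 1 / 2) 0 = x' ∧ 0 ≤ x' ∧ x' ≤ 1 ∧
        x - x ^ 2 = x' / 4 + (x' - x' ^ 2) / 4 := by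
      refine ⟨_, rfl, ?_⟩
      rcases le_total x (1 / 2) with h | h
      · rw [max_eq_right (by linarith)]
        refine ⟨by linarith, by linarith, by ring⟩
      · rw [max_eq_left (by linarith)]
        refine ⟨by linarith, by linarith, by ring⟩
    refine ⟨x', h0, h1, ?_⟩
    have hS' : a S - (a X - a X ^ 2) + (x - x ^ 2) / 4 ^ l - 1 / 4 ^ (l + 1) * x' =
        a S - (a X - a X ^ 2) + (x' - x' ^ 2) / 4 ^ (l + 1) := by
      rw [hrec, pow_succ]
      field_simp
      ring
    have hpos : 0 ≤ a S - (a X - a X ^ 2) + (x' - x' ^ 2) / 4 ^ (l + 1) := by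
      have : 0 ≤ x' - x' ^ 2 := by nlinarith
      positivity
    have hup : max (2 * F a X + (-4 * max (F a X - 1 / 2) 0 + 0 * max 0 0 + 0 * max 0 0)) 0 = x' := by
      rw [hXa, max_self, mul_zero, add_zero, add_zero, hx', max_eq_left h0]
    simp only [hup, Function.update_self, Function.update_of_ne hXS.symm, hSa, hS',
      max_eq_left hpos]
    rw [hFa]
    funext i
    by_cases i1 : i = S
    · subst i1; simp
    · by_cases i2 : i = X
      · subst i2; simp [hXS]
      · simp [i1, i2]

/-- The sum of squares of the registers `Z k`, `k < W`, up to an error of order `4 ^ (-l)`. -/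
theorem exists_square_sum {X S : ι} (hXS : X ≠ S) (Z : ℕ → ι) (hZX : ∀ k, Z k ≠ X)
    (hZS : ∀ k, Z k ≠ S) (l W : ℕ) :
    ∃ F, Prog (W * (l * 2 + 2)) F ∧ ∀ a : ι → ℝ, (∀ i, 0 ≤ a i) → (∀ k < W, a (Z k) ≤ 1) →
      a S + ∑ k ∈ Finset.range W, a (Z k) ^ 2 ≤ F a S ∧
      F a S ≤ a S + ∑ k ∈ Finset.range W, a (Z k) ^ 2 + W / 4 ^ l ∧
      ∀ i, i ≠ X → i ≠ S → F a i = a i := by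
  have hstep : ∀ k : ℕ, ∃ F, Prog (l * 2 + 2) F ∧ ∀ a : ι → ℝ, (∀ i, 0 ≤ a i) → a (Z k) ≤ 1 →
      a S + a (Z k) ^ 2 ≤ F a S ∧ F a S ≤ a S + a (Z k) ^ 2 + 1 / 4 ^ l ∧
      ∀ i, i ≠ X → i ≠ S → F a i = a i := by
    intro k
    obtain ⟨F, hF, hFs⟩ := exists_square hXS l
    have h1 : Shallow (fun a : ι → ℝ => a S + a X) := ((IsAff.proj S).add (.proj X)).shallow
    -- `S` first receives `Z k` itself; the squaring program then removes `Z k - (Z k) ^ 2`.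
    have hP := (Prog.single X (IsAff.proj (Z k)).shallow).snoc S h1
    refine ⟨_, by rw [add_comm]; exact hP.comp hF, fun a ha hk => ?_⟩
    have h0 := ha (Z k)
    have hS0 := ha S
    have hst : Function.update (Function.update a X (max (a (Z k)) 0)) S
        (max (Function.update a X (max (a (Z k)) 0) S + Function.update a X (max (a (Z k)) 0) X) 0)
        = Function.update (Function.update a X (a (Z k))) S (a S + a (Z k)) := by
      rw [max_eq_left h0, Function.update_self, Function.update_of_ne hXS.symm,
        max_eq_left (by positivity)]
    simp only [hst]
    set a₁ := Function.update (Function.update a X (a (Z k))) S (a S + a (Z k)) with ha₁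
    have hX1 : a₁ X = a (Z k) := by simp [ha₁, hXS]
    have hS1 : a₁ S = a S + a (Z k) := by simp [ha₁]
    have ho1 : ∀ i, i ≠ X → i ≠ S → a₁ i = a i := fun i h h' => by simp [ha₁, h, h']
    have hn : ∀ i, 0 ≤ a₁ i := by
      intro i
      by_cases h : i = S
      · rw [h, hS1]; positivity
      · by_cases h' : i = X
        · rw [h', hX1]; exact h0
        · rw [ho1 i h' h]; exact ha i
    obtain ⟨x', hx0, hx1, he⟩ := hFs a₁ hn (by rw [hX1]; exact hk) (by
      rw [hX1, hS1]; nlinarith [sq_nonneg (a (Z k))])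
    have hb0 : 0 ≤ (x' - x' ^ 2) / 4 ^ l := div_nonneg (by nlinarith) (by positivity)
    have hb1 : (x' - x' ^ 2) / 4 ^ l ≤ 1 / 4 ^ l := by gcongr; nlinarith [sq_nonneg x']
    rw [hX1, hS1] at he
    rw [he, Function.update_self]
    refine ⟨by linarith, by linarith, fun i h h' => ?_⟩
    simp [h, h', ho1]
  choose F hF hFs using hstep
  refine ⟨Prog.loop F W, Prog.loop_prog hF W, fun a ha h => ?_⟩
  induction W with
  | zero => simp [Prog.loop]
  | succ W ih =>
    obtain ⟨i1, i2, i3⟩ := ih (fun k hk => h k (by lia))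
    have hz : Prog.loop F W a (Z W) = a (Z W) := i3 _ (hZX W) (hZS W)
    obtain ⟨j1, j2, j3⟩ := hFs W _ ((Prog.loop_prog hF W).nonneg ha) (by
      rw [hz]; exact h W (by lia))
    rw [hz] at j1 j2
    simp only [Prog.loop, Finset.sum_range_succ]
    refine ⟨by linarith, ?_, fun i h h' => by rw [j3 i h h', i3 i h h']⟩
    have : ((W + 1 : ℕ) : ℝ) / 4 ^ l = W / 4 ^ l + 1 / 4 ^ l := by push_cast; ring
    linarith

/-- The maximum over `j < N` of `y j` times a truncated affine functional. -/
theorem exists_max_tents {H O : ι} (hHO : H ≠ O) {m : ℕ → (ι → ℝ) → ℝ} (hm : ∀ j, IsAff (m j))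
    (hdep : ∀ j a b, (∀ i, i ≠ H → i ≠ O → a i = b i) → m j a = m j b) (y : ℕ → ℝ)
    (hy : ∀ j, 0 ≤ y j) (N : ℕ) :
    ∃ F, Prog (N * 2) F ∧ ∀ a : ι → ℝ, (∀ i, 0 ≤ a i) → a O = 0 → ∀ j₀ < N, m j₀ a ≤ 0 →
      (∀ j < N, y j = y j₀ ∨ 1 ≤ m j a) → F a O = y j₀ := by
  have hstep : ∀ j : ℕ, ∃ F, Prog 2 F ∧ ∀ a : ι → ℝ, (∀ i, 0 ≤ a i) →
      F a O = max (a O) (y j * max (1 - max (m j a) 0) 0) ∧ ∀ i, i ≠ H → i ≠ O → F a i = a i := by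
    intro j
    have h1 : Shallow (fun a : ι → ℝ => 1 + (-1 * max (m j a) 0 + 0 * max 0 0 + 0 * max 0 0)) :=
      Shallow.of_neurons _ _ _ (.const 1) (hm j) (.const 0) (.const 0)
    have h2 : Shallow (fun a : ι → ℝ =>
        y j * a H + (1 * max (a O - y j * a H) 0 + 0 * max 0 0 + 0 * max 0 0)) :=
      Shallow.of_neurons _ _ _ ((IsAff.proj H).const_mul _)
        ((IsAff.proj O).sub ((IsAff.proj H).const_mul _)) (.const 0) (.const 0)
    refine ⟨_, (Prog.single H h1).snoc O h2, fun a ha => ⟨?_, fun i h h' => by simp [h, h']⟩⟩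
    simp only [Function.update_self, Function.update_of_ne hHO.symm, max_self, mul_zero, add_zero,
      one_mul, neg_mul, ← sub_eq_add_neg]
    set t := y j * max (1 - max (m j a) 0) 0 with ht
    have ht0 : 0 ≤ t := mul_nonneg (hy j) (le_max_right _ _)
    rcases le_total (a O) t with h | h
    · rw [max_eq_right (by linarith : a O - t ≤ 0), max_eq_right h, add_zero, max_eq_left ht0]
    · rw [max_eq_left (by linarith : 0 ≤ a O - t), max_eq_left h, add_sub_cancel,
        max_eq_left (ha O)]
  choose F hF hFs using hstep
  refine ⟨Prog.loop F N, Prog.loop_prog hF N, fun a ha hO j₀ hj₀ hm₀ hj => ?_⟩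
  -- Tents of other labels vanish, those of the same label stay below `y j₀`, and the tent of `j₀`
  -- attains it.
  have key : ∀ n ≤ N, Prog.loop F n a O ≤ y j₀ ∧ (j₀ < n → y j₀ ≤ Prog.loop F n a O) ∧
      ∀ i, i ≠ H → i ≠ O → Prog.loop F n a i = a i := by
    intro n hn
    induction n with
    | zero => simp [Prog.loop, hO, hy j₀]
    | succ n ih =>
      obtain ⟨i1, i2, i3⟩ := ih (by lia)
      obtain ⟨k1, k2⟩ := hFs n _ ((Prog.loop_prog hF n).nonneg ha)
      rw [hdep n _ a i3] at k1
      simp only [Prog.loop]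
      rw [k1]
      refine ⟨max_le i1 ?_, fun h => ?_, fun i h h' => by rw [k2 i h h', i3 i h h']⟩
      · rcases hj n (by lia) with h | h
        · rw [h]
          have : max (1 - max (m n a) 0) 0 ≤ 1 := max_le (by linarith [le_max_right (m n a) 0]) zero_le_one
          exact mul_le_of_le_one_right (hy _) this
        · have : max (1 - max (m n a) 0) 0 = 0 := max_eq_right (by linarith [le_max_left (m n a) 0])
          rw [this, mul_zero]
          exact hy _
      · rcases Nat.lt_succ_iff_lt_or_eq.1 h with h | rfl
        · exact (i2 h).trans (le_max_left _ _)
        · refine le_trans ?_ (le_max_right _ _)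
          rw [max_eq_right hm₀]
          simp
  obtain ⟨k1, k2, _⟩ := key N le_rfl
  exact le_antisymm k1 (k2 hj₀)

theorem IsAff.of_linearMap (f : (ι → ℝ) →ₗ[ℝ] ℝ) : IsAff f :=
  ⟨fun j => f (Pi.single j 1), 0, fun a => by
    rw [LinearMap.pi_apply_eq_sum_univ f a, add_zero]
    refine Finset.sum_congr rfl fun j _ => ?_
    rw [smul_eq_mul, mul_comm]
    congr 2
    ext k
    simp [Pi.single_apply, eq_comm]⟩

theorem sum_sq_add_ge {κ : Type*} [Fintype κ] {p q : κ → ℝ} {A B : ℝ} (hA : 0 ≤ A)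
    (hB : 0 ≤ B) (hBA : B ≤ A) (hp : A ^ 2 ≤ ∑ k, p k ^ 2) (hq : ∑ k, q k ^ 2 ≤ B ^ 2) :
    (A - B) ^ 2 ≤ ∑ k, (p k + q k) ^ 2 := by
  have e : ∀ v : κ → ℝ, ∑ k, v k ^ 2 = ‖WithLp.toLp 2 v‖ ^ 2 := fun v => by
    rw [EuclideanSpace.norm_sq_eq]; simp
  rw [e] at hp hq
  have h3 := e (fun k => p k + q k)
  rw [h3]
  have hp' := (sq_le_sq₀ hA (norm_nonneg _)).1 hp
  have hq' := (sq_le_sq₀ (norm_nonneg _) hB).1 hq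
  have h4 : WithLp.toLp 2 (fun k => p k + q k) = WithLp.toLp 2 p + WithLp.toLp 2 q := rfl
  rw [h4]
  have h5 : ‖WithLp.toLp 2 p‖ ≤ ‖WithLp.toLp 2 p + WithLp.toLp 2 q‖ + ‖WithLp.toLp 2 q‖ := by
    have := norm_sub_le (WithLp.toLp 2 p + WithLp.toLp 2 q) (WithLp.toLp 2 q)
    simpa using this
  exact pow_le_pow_left₀ (by linarith) (by linarith) 2

/-- A network that compares the distances, after a linear map, to all data points. -/
theorem exists_ball_net {d N W l : ℕ} {x : Fin N → Fin d → ℝ} {y : Fin N → ℕ} {r ρ M : ℝ}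
    (A : Fin W → (Fin d → ℝ) →ₗ[ℝ] ℝ) (hρ0 : 0 ≤ ρ) (hρ1 : ρ < 1) (hM : 1 ≤ M)
    (hsep : ∀ i j, y i ≠ y j → 4 ≤ ∑ k, A k (x i - x j) ^ 2)
    (hball : ∀ i z, ∑ t, (z t - x i t) ^ 2 ≤ r ^ 2 → ∑ k, A k (z - x i) ^ 2 ≤ ρ ^ 2)
    (hxM : ∀ i k, |A k (x i)| ≤ M - 1) (hl : 4 * M ^ 2 * (W / 4 ^ l) ≤ 2 * (1 - ρ)) :
    ∃ net : ReLUNet d,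
      net.numParams ≤ (d + 2) * (W + 6) + 2 * (W * (l * 2 + 2) + N * 2) * (W + 9) ^ 2 ∧
      ∀ i z, ∑ t, (z t - x i t) ^ 2 ≤ r ^ 2 → net.eval z = y i := by
  classical
  have hM0 : 0 < M := by linarith
  let Z : ℕ → Fin W ⊕ Fin 5 := fun k => if h : k < W then Sum.inl ⟨k, h⟩ else Sum.inr 4
  -- The coordinates are mapped into `[0, 1]`, where the squaring program works; `M` leaves room `1`
  -- for the ball.
  let zc : Fin W → (Fin d → ℝ) → ℝ := fun k z => (2 * M)⁻¹ * A k z + 1 / 2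
  have hzc : ∀ k, IsAff (zc k) := fun k => ((IsAff.of_linearMap _).const_mul _).add (.const _)
  -- Expanding the square makes the distance affine once the sum of squares is in a register. The
  -- gap `(2 - ρ) ^ 2 - ρ ^ 2 = 4 (1 - ρ)` is split evenly: one half absorbs the squaring error, the
  -- other is the slope width of the tent.
  let m₀ : Fin N → (Fin W ⊕ Fin 5 → ℝ) → ℝ := fun i a =>
    (2 * (1 - ρ))⁻¹ * (4 * M ^ 2 * (a (Sum.inr 1) - 2 * ∑ k, zc k (x i) * a (Sum.inl k) +
      ∑ k, zc k (x i) ^ 2) - ρ ^ 2 - 2 * (1 - ρ))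
  have hm₀ : ∀ i, IsAff (m₀ i) := fun i =>
    ((((((IsAff.proj _).sub ((IsAff.sum _ fun k => (IsAff.proj _).const_mul _).const_mul _)).add
      (.const _)).const_mul _).sub (.const _)).sub (.const _)).const_mul _
  let m : ℕ → (Fin W ⊕ Fin 5 → ℝ) → ℝ := fun j => if h : j < N then m₀ ⟨j, h⟩ else fun _ => 0
  have hm : ∀ j, IsAff (m j) := by
    intro j
    simp only [m]
    split_ifs
    · exact hm₀ _
    · exact IsAff.const 0
  have hdep : ∀ j a b, (∀ i, i ≠ Sum.inr 2 → i ≠ Sum.inr 3 → a i = b i) → m j a = m j b := by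
    intro j a b h
    simp only [m]
    split_ifs
    · simp only [m₀]
      rw [h (Sum.inr 1) (by simp) (by simp)]
      simp only [fun k => h (Sum.inl k) (by simp) (by simp)]
    · rfl
  let y' : ℕ → ℝ := fun j => if h : j < N then y ⟨j, h⟩ else 0
  have hy' : ∀ j, 0 ≤ y' j := by
    intro j
    simp only [y']
    split_ifs <;> positivity
  obtain ⟨F₁, hF₁, hF₁s⟩ := exists_square_sum (ι := Fin W ⊕ Fin 5) (X := Sum.inr 0) (S := Sum.inr 1) (by simp) Z
    (fun k => by simp only [Z]; split_ifs <;> simp) (fun k => by simp only [Z]; split_ifs <;> simp) l W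
  obtain ⟨F₂, hF₂, hF₂s⟩ := exists_max_tents (ι := Fin W ⊕ Fin 5) (H := Sum.inr 2) (O := Sum.inr 3) (by simp) hm
    hdep y' hy' N
  obtain ⟨net, hnet, hev⟩ := (hF₁.comp hF₂).exists_reluNet (A := Sum.elim zc (fun _ _ => 0))
    (by rintro (k | k); exacts [hzc k, IsAff.const 0]) (Sum.inr 3)
  refine ⟨net, by simpa [add_assoc] using hnet, fun i z hz => ?_⟩
  set a : Fin W ⊕ Fin 5 → ℝ := fun j => max (Sum.elim zc (fun _ _ => 0) j z) 0 with ha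
  have han : ∀ i, 0 ≤ a i := fun _ => le_max_right _ _
  have hb := hball i z hz
  have hzr : ∀ k, 0 ≤ zc k z ∧ zc k z ≤ 1 := by
    intro k
    have h1 : A k (z - x i) ^ 2 ≤ 1 ^ 2 := by
      refine (Finset.single_le_sum (f := fun k => A k (z - x i) ^ 2)
        (fun _ _ => sq_nonneg _) (Finset.mem_univ k)).trans (hb.trans ?_)
      gcongr
    have h2 := abs_le_of_sq_le_sq h1 zero_le_one
    have h3 : |A k z| ≤ M := by
      have : A k z = A k (z - x i) + A k (x i) := by rw [← map_add, sub_add_cancel]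
      rw [this]
      exact (abs_add_le _ _).trans (by linarith [hxM i k])
    have h4 : |(2 * M)⁻¹ * A k z| ≤ 1 / 2 := by
      rw [abs_mul, abs_of_pos (by positivity), inv_mul_le_iff₀ (by positivity)]
      linarith
    have := abs_le.1 h4
    simp only [zc]
    constructor <;> linarith
  have haz : ∀ k, a (Sum.inl k) = zc k z := fun k => max_eq_left (hzr k).1
  have haZ : ∀ k (hk : k < W), a (Z k) = zc ⟨k, hk⟩ z := fun k hk => by
    simp only [Z, dif_pos hk]; exact haz _
  have har : ∀ k, a (Sum.inr k) = 0 := fun k => max_self _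
  obtain ⟨s1, s2, s3⟩ := hF₁s a han (fun k hk => by rw [haZ k hk]; exact (hzr _).2)
  have hsq : ∑ k ∈ Finset.range W, a (Z k) ^ 2 = ∑ k, zc k z ^ 2 := by
    rw [Finset.sum_range]
    exact Finset.sum_congr rfl fun k _ => by rw [haZ k k.2]
  rw [har, zero_add, hsq] at s1 s2
  set b := F₁ a with hbdef
  have hbz : ∀ k, b (Sum.inl k) = zc k z := fun k => by rw [s3 _ (by simp) (by simp), haz]
  have hdist : ∀ j, 4 * M ^ 2 * (∑ k, zc k z ^ 2 - 2 * ∑ k, zc k (x j) * zc k z +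
      ∑ k, zc k (x j) ^ 2) = ∑ k, A k (z - x j) ^ 2 := by
    intro j
    rw [Finset.mul_sum, ← Finset.sum_sub_distrib, ← Finset.sum_add_distrib, Finset.mul_sum]
    refine Finset.sum_congr rfl fun k _ => ?_
    simp only [zc, map_sub]
    field_simp
    ring
  obtain ⟨e, he0, he1, he⟩ : ∃ e : ℝ, 0 ≤ e ∧ e ≤ W / 4 ^ l ∧ b (Sum.inr 1) = ∑ k, zc k z ^ 2 + e :=
    ⟨b (Sum.inr 1) - ∑ k, zc k z ^ 2, by linarith, by linarith, by ring⟩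
  have hmb : ∀ j : Fin N, m j b =
      (2 * (1 - ρ))⁻¹ * (∑ k, A k (z - x j) ^ 2 + 4 * M ^ 2 * e - ρ ^ 2 - 2 * (1 - ρ)) := by
    intro j
    simp only [m, dif_pos j.2, m₀]
    rw [← hdist j, he]
    simp only [hbz]
    ring
  have he2 : 4 * M ^ 2 * e ≤ 2 * (1 - ρ) := le_trans (by gcongr) hl
  have hρ' : 0 < 2 * (1 - ρ) := by linarith
  have hfin := hF₂s b (hF₁.nonneg han) (by rw [s3 _ (by simp) (by simp), har]) i i.2
    (by
      rw [hmb i]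
      exact mul_nonpos_of_nonneg_of_nonpos (by positivity) (by linarith))
    (by
      intro j hj
      by_cases h : y ⟨j, hj⟩ = y i
      · left
        simp [y', hj, h]
      · right
        have hmj := hmb ⟨j, hj⟩
        simp only at hmj
        rw [hmj, le_inv_mul_iff₀ hρ', mul_one]
        have h1 := hsep i ⟨j, hj⟩ (fun h' => h h'.symm)
        have h2 := sum_sq_add_ge (p := fun k => A k (x i - x ⟨j, hj⟩)) (q := fun k => A k (z - x i))
          zero_le_two hρ0 (by linarith) (le_trans (by norm_num) h1) hb
        have h3 : ∑ k, (A k (x i - x ⟨j, hj⟩) + A k (z - x i)) ^ 2 =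
            ∑ k, A k (z - x ⟨j, hj⟩) ^ 2 := by
          refine Finset.sum_congr rfl fun k _ => ?_
          rw [← map_add, add_comm, sub_add_sub_cancel]
        rw [h3] at h2
        have h4 : 0 ≤ 4 * M ^ 2 * e := by positivity
        nlinarith)
  rw [hev, hfin]
  simp [y']

end Balls

/-! ### Linear maps that preserve the separation of the data -/

section Rows

/-- Coordinates in an orthonormal basis of the span of the data. -/
theorem exists_span_coordinates {N d : ℕ} (x : Fin N → Fin d → ℝ) :
    ∃ (D : ℕ) (B : Fin D → (Fin d → ℝ) →ₗ[ℝ] ℝ), D ≤ N ∧ D ≤ d ∧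
      (∀ v, ∑ k, B k v ^ 2 ≤ ∑ t, v t ^ 2) ∧
      ∀ i j, ∑ k, B k (x i - x j) ^ 2 = ∑ t, (x i t - x j t) ^ 2 := by
  let E := EuclideanSpace ℝ (Fin d)
  let X : Fin N → E := fun i => WithLp.toLp 2 (x i)
  let V : Submodule ℝ E := Submodule.span ℝ (Set.range X)
  let b := stdOrthonormalBasis ℝ V
  have hb : Orthonormal ℝ (fun k => (b k : E)) := b.orthonormal.comp_linearIsometry V.subtypeₗᵢ
  have e : ∀ v : Fin d → ℝ, ∑ k, v k ^ 2 = ‖(WithLp.toLp 2 v : E)‖ ^ 2 := fun v => by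
    rw [EuclideanSpace.norm_sq_eq]; simp
  refine ⟨Module.finrank ℝ V, fun k => (innerₛₗ ℝ (b k : E)).comp
    (WithLp.linearEquiv 2 ℝ (Fin d → ℝ)).symm.toLinearMap, ?_, ?_, fun v => ?_, fun i j => ?_⟩
  · have := finrank_range_le_card (R := ℝ) X
    rwa [Fintype.card_fin] at this
  · simpa [E] using Submodule.finrank_le V
  · rw [e v]
    have := hb.sum_inner_products_le (x := (WithLp.toLp 2 v : E)) (s := Finset.univ)
    simpa using this
  · have hv : (WithLp.toLp 2 (x i - x j) : E) ∈ V :=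
      V.sub_mem (Submodule.subset_span ⟨i, rfl⟩) (Submodule.subset_span ⟨j, rfl⟩)
    have h1 := b.sum_sq_norm_inner_right ⟨_, hv⟩
    have h2 := e (x i - x j)
    simp only [Pi.sub_apply] at h2
    rw [h2]
    simpa using h1

/-- Division into consecutive buckets of size `β`. -/
theorem card_filter_div_le {D β : ℕ} (hβ : 0 < β) (k : ℕ) :
    (Finset.univ.filter fun t : Fin D => (t : ℕ) / β = k).card ≤ β := by
  have : ((Finset.univ.filter fun t : Fin D => (t : ℕ) / β = k).map Fin.valEmbedding) ⊆
      Finset.Ico (k * β) (k * β + β) := by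
    intro t ht
    simp only [Finset.mem_map, Finset.mem_filter, Finset.mem_univ, true_and] at ht
    obtain ⟨a, ha, rfl⟩ := ht
    have := Nat.div_add_mod' (a : ℕ) β
    have := Nat.mod_lt (a : ℕ) hβ
    rw [ha] at *
    simp only [Fin.valEmbedding_apply, Finset.mem_Ico]
    lia
  have := Finset.card_le_card this
  simpa using this

/-- Cauchy–Schwarz inside each bucket costs its size. Unlike the lower bound, this holds for every
choice of signs and every vector, as is needed for whole balls. -/
theorem sum_bucket_signSum_sq_le {D m β : ℕ} (bk : Fin D → Fin m)
    (hβ : ∀ k, (Finset.univ.filter fun t => bk t = k).card ≤ β) (s : Fin D → Bool)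
    (v : Fin D → ℝ) :
    ∑ k, signSum s (fun t => if bk t = k then v t else 0) ^ 2 ≤ β * ∑ t, v t ^ 2 := by
  have hk : ∀ k, signSum s (fun t => if bk t = k then v t else 0) ^ 2 ≤
      β * ∑ t, if bk t = k then v t ^ 2 else 0 := by
    intro k
    have e : signSum s (fun t => if bk t = k then v t else 0) =
        ∑ t ∈ Finset.univ.filter (fun t => bk t = k), boolSign (s t) * v t := by
      simp only [signSum, mul_ite, mul_zero, Finset.sum_filter]
    rw [e, ← Finset.sum_filter]
    refine (Finset.sum_mul_sq_le_sq_mul_sq _ _ _).trans ?_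
    simp only [boolSign_sq, Finset.sum_const, nsmul_eq_mul, mul_one]
    gcongr
    exact hβ k
  refine (Finset.sum_le_sum fun k _ => hk k).trans (le_of_eq ?_)
  rw [← Finset.mul_sum, Finset.sum_comm]
  simp

theorem signCount_pos (N : ℕ) : 0 < signCount N := Nat.succ_pos _

/-- A linear map to few dimensions that keeps differently labelled points apart, while it does
not enlarge the balls too much. -/
theorem exists_rows {N d : ℕ} {x : Fin N → Fin d → ℝ} {y : Fin N → ℕ} {ε ρ : ℝ}
    (hN : 0 < N) (hε : 0 < ε) (hρ : 0 < ρ)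
    (hsep : ∀ i j, y i ≠ y j → 4 * ε ^ 2 ≤ ∑ t, (x i t - x j t) ^ 2) :
    ∃ (W : ℕ) (A : Fin W → (Fin d → ℝ) →ₗ[ℝ] ℝ) (κ : ℝ),
      (W : ℝ) ≤ 23 * (signCount N : ℝ) ^ 2 * (min (N : ℝ) d * ρ ^ 2 + 1) ∧ 0 ≤ κ ∧
      κ * (ρ * ε) ≤ max (1 / 2) ρ ∧
      (∀ i j, y i ≠ y j → 4 ≤ ∑ k, A k (x i - x j) ^ 2) ∧
      ∀ v, ∑ k, A k v ^ 2 ≤ κ ^ 2 * ∑ t, v t ^ 2 := by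
  obtain ⟨D, B, hDN, hDd, hBle, hBeq⟩ := exists_span_coordinates x
  have hcov : ∀ (m : ℕ) (bk : Fin D → Fin m), _ := fun m bk =>
    exists_signs hN bk (fun i t => B t (x i))
  have hL1 : 1 ≤ signCount N := signCount_pos N
  generalize signCount N = L at hcov hL1 ⊢
  replace hL1 : (1 : ℝ) ≤ L := by exact_mod_cast hL1
  have hD : (D : ℝ) ≤ min (N : ℝ) d := le_min (by exact_mod_cast hDN) (by exact_mod_cast hDd)
  have hD0 : (0 : ℝ) ≤ D := by positivity
  -- For large `ρ` the factor lost by a random sketch is not affordable, but the bound on `W` then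
  -- admits all `D` span coordinates. For small `ρ`, bucketed signs reduce the dimension.
  by_cases hcase : 9 / 25 < 4 * L * ρ ^ 2
  · refine ⟨D, fun k => ε⁻¹ • B k, ε⁻¹, ?_, by positivity, ?_, fun i j hij => ?_, fun v => ?_⟩
    · have h1 : (D : ℝ) * (9 / 25) ≤ D * (4 * L * ρ ^ 2) := by gcongr
      have h2 : (D : ℝ) * ρ ^ 2 * L ≤ min (N : ℝ) d * ρ ^ 2 * L ^ 2 := by
        gcongr
        nlinarith
      have h3 : 0 ≤ min (N : ℝ) d * ρ ^ 2 * L ^ 2 := le_trans (by positivity) h2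
      nlinarith
    · have : ε⁻¹ * (ρ * ε) = ρ := by field_simp
      rw [this]
      exact le_max_right _ _
    · simp only [LinearMap.smul_apply, smul_eq_mul, mul_pow, ← Finset.mul_sum, hBeq]
      have := hsep i j hij
      rw [inv_pow, le_inv_mul_iff₀ (by positivity)]
      linarith
    · simp only [LinearMap.smul_apply, smul_eq_mul, mul_pow, ← Finset.mul_sum]
      gcongr
      exact hBle v
  · push Not at hcase
    have hLρ : 0 < 4 * L * ρ ^ 2 := by positivity
    -- The largest bucket size with `L * β * ρ ^ 2 ≤ 9 / 100`, so that the scaled ball has radius at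
    -- most `5 / 3 * 3 / 10 = 1 / 2`.
    set β := ⌊9 / 25 / (4 * L * ρ ^ 2)⌋₊ with hβ
    have hβ1 : 1 ≤ β := by
      rw [hβ, Nat.one_le_floor_iff, le_div_iff₀ hLρ]
      linarith
    have hβR : (1 : ℝ) ≤ β := by exact_mod_cast hβ1
    have hβle : (β : ℝ) ≤ 9 / 25 / (4 * L * ρ ^ 2) := Nat.floor_le (by positivity)
    have hβge : 9 / 25 / (4 * L * ρ ^ 2) < β + 1 := Nat.lt_floor_add_one _
    rw [le_div_iff₀ hLρ] at hβle
    rw [div_lt_iff₀ hLρ] at hβge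
    obtain ⟨m, bk, hm, hbk⟩ : ∃ (m : ℕ) (bk : Fin D → Fin m), m = D / β + 1 ∧
        ∀ k, (Finset.univ.filter fun t => bk t = k).card ≤ β :=
      ⟨D / β + 1, fun t => ⟨t / β, Nat.lt_succ_of_le (Nat.div_le_div_right t.2.le)⟩, rfl,
        fun k => by simpa [Fin.ext_iff] using card_filter_div_le (D := D) hβ1 k⟩
    obtain ⟨s, hs⟩ := hcov _ bk
    -- All sketches are stacked, so that the one good for a given pair contributes. The factor `5 /
    -- 3` compensates the `9 / 25` in the sketch bound.
    let A₀ : Fin L × Fin m → (Fin d → ℝ) →ₗ[ℝ] ℝ := fun p =>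
      ((5 / 3 : ℝ) * ε⁻¹) • ∑ t, (if bk t = p.2 then boolSign (s p.1 t) else 0) • B t
    have hA₀ : ∀ p v, A₀ p v =
        5 / 3 * ε⁻¹ * signSum (s p.1) (fun t => if bk t = p.2 then B t v else 0) := by
      intro p v
      simp only [A₀, LinearMap.smul_apply, LinearMap.sum_apply, smul_eq_mul, signSum]
      congr 1
      refine Finset.sum_congr rfl fun t _ => ?_
      split_ifs <;> simp
    have hsum : ∀ v, ∑ k, A₀ (finProdFinEquiv.symm k) v ^ 2 = (5 / 3 * ε⁻¹) ^ 2 *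
        ∑ l, ∑ k, signSum (s l) (fun t => if bk t = k then B t v else 0) ^ 2 := by
      intro v
      rw [Equiv.sum_comp finProdFinEquiv.symm (fun p => A₀ p v ^ 2), Fintype.sum_prod_type]
      simp only [hA₀, mul_pow, ← Finset.mul_sum]
    refine ⟨L * m, fun k => A₀ (finProdFinEquiv.symm k), 5 / 3 * ε⁻¹ * √(L * β), ?_, by positivity,
      ?_, fun i j hij => ?_, fun v => ?_⟩
    · have h1 : ((D / β : ℕ) : ℝ) ≤ D / β := Nat.cast_div_le
      have h2 : (9 / 25 : ℝ) ≤ 8 * L * ρ ^ 2 * β := by nlinarith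
      have h3 : (D : ℝ) / β ≤ D * (200 / 9 * L * ρ ^ 2) := by
        rw [div_le_iff₀ (by positivity)]
        nlinarith
      have h4 : (D : ℝ) * (200 / 9 * L * ρ ^ 2) ≤ 23 * L * (min (N : ℝ) d * ρ ^ 2) := by
        have : (D : ℝ) * (L * ρ ^ 2) ≤ min (N : ℝ) d * (L * ρ ^ 2) := by gcongr
        have : 0 ≤ (D : ℝ) * (L * ρ ^ 2) := by positivity
        nlinarith
      have h5 : (m : ℝ) ≤ 23 * L * (min (N : ℝ) d * ρ ^ 2) + 1 := by
        rw [hm]; push_cast; linarith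
      push_cast
      calc (L : ℝ) * m ≤ L * (23 * L * (min (N : ℝ) d * ρ ^ 2) + 1) := by gcongr
        _ ≤ _ := by nlinarith
    · refine le_trans ?_ (le_max_left _ _)
      have e : 5 / 3 * ε⁻¹ * √(L * β) * (ρ * ε) = 5 / 3 * (√(L * β) * ρ) := by field_simp
      rw [e]
      have : √(L * β) * ρ ≤ 3 / 10 := by
        refine abs_le_of_sq_le_sq' ?_ (by norm_num) |>.2
        rw [mul_pow, Real.sq_sqrt (by positivity)]
        nlinarith
      linarith
    · rw [hsum]
      obtain ⟨l, hl⟩ := hs i j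
      have h1 : ∑ k, signSum (s l) (fun t => if bk t = k then B t (x i - x j) else 0) ^ 2 ≤
          ∑ l, ∑ k, signSum (s l) (fun t => if bk t = k then B t (x i - x j) else 0) ^ 2 :=
        Finset.single_le_sum (f := fun l => ∑ k, signSum (s l)
          (fun t => if bk t = k then B t (x i - x j) else 0) ^ 2)
          (fun _ _ => Finset.sum_nonneg fun _ _ => sq_nonneg _) (Finset.mem_univ l)
      simp only [← map_sub] at hl
      rw [hBeq] at hl
      have h2 := hsep i j hij
      have h3 : 36 / 25 * ε ^ 2 ≤
          ∑ l, ∑ k, signSum (s l) (fun t => if bk t = k then B t (x i - x j) else 0) ^ 2 := by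
        linarith
      calc (4 : ℝ) = (5 / 3 * ε⁻¹) ^ 2 * (36 / 25 * ε ^ 2) := by field_simp; norm_num
        _ ≤ _ := by gcongr
    · rw [hsum]
      have h1 : ∑ l, ∑ k, signSum (s l) (fun t => if bk t = k then B t v else 0) ^ 2 ≤
          L * (β * ∑ t, v t ^ 2) := by
        calc _ ≤ ∑ l : Fin L, (β : ℝ) * ∑ t, v t ^ 2 := Finset.sum_le_sum fun l _ =>
              (sum_bucket_signSum_sq_le bk hbk (s l) _).trans (by gcongr; exact hBle v)
          _ = _ := by simp
      rw [mul_pow _ (√_), Real.sq_sqrt (by positivity)]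
      calc _ ≤ (5 / 3 * ε⁻¹) ^ 2 * (L * (β * ∑ t, v t ^ 2)) := by gcongr
        _ = _ := by ring

end Rows

/-! ### Comparison of norms and elementary facts on datasets -/

section Norms

/-- With `S` the `ℓ_s` norm, every `|v i|` is at most `S`, hence `|v i| ^ t ≤ |v i| ^ s * S ^ (t -
s)`. -/
theorem rpow_sum_antitone {d : ℕ} (v : Fin d → ℝ) {s t : ℝ} (hs : 0 < s) (hst : s ≤ t) :
    (∑ i, |v i| ^ t) ^ (1 / t) ≤ (∑ i, |v i| ^ s) ^ (1 / s) := by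
  have ht : 0 < t := hs.trans_le hst
  have hsum : 0 ≤ ∑ i, |v i| ^ s := Finset.sum_nonneg fun _ _ => by positivity
  set S := (∑ i, |v i| ^ s) ^ (1 / s) with hS
  have hS0 : 0 ≤ S := by positivity
  have hSs : S ^ s = ∑ i, |v i| ^ s := by
    rw [hS, ← Real.rpow_mul hsum, one_div, inv_mul_cancel₀ hs.ne', Real.rpow_one]
  have hle : ∀ i, |v i| ≤ S := fun i => by
    rw [← Real.rpow_le_rpow_iff (abs_nonneg _) hS0 hs, hSs]
    exact Finset.single_le_sum (f := fun i => |v i| ^ s) (fun _ _ => by positivity)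
      (Finset.mem_univ i)
  have hmain : ∑ i, |v i| ^ t ≤ S ^ t := by
    have e : S ^ t = S ^ s * S ^ (t - s) := by
      rw [← Real.rpow_add_of_nonneg hS0 hs.le (by linarith)]; congr 1; ring
    rw [e, hSs, Finset.sum_mul]
    refine Finset.sum_le_sum fun i _ => ?_
    calc |v i| ^ t = |v i| ^ s * |v i| ^ (t - s) := by
          rw [← Real.rpow_add_of_nonneg (abs_nonneg _) hs.le (by linarith)]; congr 1; ring
      _ ≤ |v i| ^ s * S ^ (t - s) := by
          gcongr
          exact hle i
  calc (∑ i, |v i| ^ t) ^ (1 / t) ≤ (S ^ t) ^ (1 / t) := by gcongr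
    _ = S := by rw [← Real.rpow_mul hS0, one_div, mul_inv_cancel₀ ht.ne', Real.rpow_one]

/-- The power mean inequality with exponent `t / s`. -/
theorem rpow_sum_le_card_mul {d : ℕ} (v : Fin d → ℝ) {s t : ℝ} (hs : 0 < s) (hst : s ≤ t) :
    (∑ i, |v i| ^ s) ^ (1 / s) ≤ (d : ℝ) ^ (1 / s - 1 / t) * (∑ i, |v i| ^ t) ^ (1 / t) := by
  have ht : 0 < t := hs.trans_le hst
  have hsum : 0 ≤ ∑ i, |v i| ^ s := Finset.sum_nonneg fun _ _ => by positivity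
  have hsum' : 0 ≤ ∑ i, |v i| ^ t := Finset.sum_nonneg fun _ _ => by positivity
  have h := Real.rpow_sum_le_const_mul_sum_rpow_of_nonneg (p := t / s) (f := fun i => |v i| ^ s)
    Finset.univ ((one_le_div hs).2 hst) (fun i _ => by positivity)
  have e : ∀ i, (|v i| ^ s) ^ (t / s) = |v i| ^ t := fun i => by
    rw [← Real.rpow_mul (abs_nonneg _)]; congr 1; field_simp
  simp only [e, Finset.card_univ, Fintype.card_fin] at h
  have h2 := Real.rpow_le_rpow (by positivity) h (by positivity : 0 ≤ 1 / t)
  rw [← Real.rpow_mul hsum, Real.mul_rpow (by positivity) hsum',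
    ← Real.rpow_mul (by positivity)] at h2
  have e1 : t / s * (1 / t) = 1 / s := by field_simp
  have e2 : (t / s - 1) * (1 / t) = 1 / s - 1 / t := by field_simp
  rwa [e1, e2] at h2

theorem sqrt_sum_sq_eq_rpow {d : ℕ} (v : Fin d → ℝ) :
    √(∑ i, v i ^ 2) = (∑ i, |v i| ^ (2 : ℝ)) ^ (1 / (2 : ℝ)) := by
  rw [Real.sqrt_eq_rpow]
  congr 1
  refine Finset.sum_congr rfl fun i _ => ?_
  rw [Real.rpow_two, sq_abs]

theorem ellNorm_top {d : ℕ} (v : Fin d → ℝ) : ellNorm ∞ v = ‖v‖ := by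
  rw [ellNorm, PiLp.norm_toLp]

theorem ellNorm_eq_sum {p : ℝ≥0∞} (hp : 1 ≤ p) (hp' : p ≠ ∞) {d : ℕ} (v : Fin d → ℝ) :
    ellNorm p v = (∑ i, |v i| ^ p.toReal) ^ (1 / p.toReal) := by
  have : 0 < p.toReal := ENNReal.toReal_pos (by positivity) hp'
  rw [ellNorm, PiLp.norm_eq_sum this]
  rfl

theorem gammaP_pos {p : ℝ≥0∞} {d : ℕ} (hd : 0 < d) : 0 < gammaP p d := by
  rw [gammaP]; positivity

theorem one_le_gammaP {p : ℝ≥0∞} {d : ℕ} (hd : 0 < d) : 1 ≤ gammaP p d :=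
  Real.one_le_rpow (by exact_mod_cast hd) (abs_nonneg _)

theorem gammaP_le {p : ℝ≥0∞} (hp : 1 ≤ p) {d : ℕ} (hd : 0 < d) : gammaP p d ≤ d := by
  have h1 : (1 : ℝ) ≤ d := by exact_mod_cast hd
  have h2 : (p⁻¹).toReal ≤ 1 := by
    have := ENNReal.toReal_mono ENNReal.one_ne_top (ENNReal.inv_le_one.2 hp)
    simpa using this
  have h3 : 0 ≤ (p⁻¹).toReal := ENNReal.toReal_nonneg
  calc gammaP p d ≤ (d : ℝ) ^ (1 : ℝ) := by
        refine Real.rpow_le_rpow_of_exponent_le h1 (abs_le.2 ⟨by linarith, by linarith⟩)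
    _ = d := Real.rpow_one _

/-- The Euclidean norm and the `ℓ_p` norm agree up to a scaling and a factor in `[1, γ_p]`. -/
theorem exists_scale_ellNorm {p : ℝ≥0∞} (hp : 1 ≤ p) {d : ℕ} (hd : 0 < d) :
    ∃ a : ℝ, 0 < a ∧ ∀ v : Fin d → ℝ, a * ellNorm p v ≤ √(∑ i, v i ^ 2) ∧
      √(∑ i, v i ^ 2) ≤ gammaP p d * a * ellNorm p v := by
  by_cases htop : p = ∞
  · subst htop
    refine ⟨1, one_pos, fun v => ?_⟩
    have hγ : gammaP ∞ d = √d := by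
      rw [gammaP, Real.sqrt_eq_rpow]; simp
    rw [hγ, ellNorm_top, one_mul, mul_one]
    constructor
    · refine (pi_norm_le_iff_of_nonneg (Real.sqrt_nonneg _)).2 fun i => ?_
      rw [Real.norm_eq_abs]
      refine Real.abs_le_sqrt ?_
      exact Finset.single_le_sum (f := fun i => v i ^ 2) (fun _ _ => sq_nonneg _) (Finset.mem_univ i)
    · rw [← Real.sqrt_sq (norm_nonneg v), ← Real.sqrt_mul (by positivity)]
      refine Real.sqrt_le_sqrt ?_
      calc ∑ i, v i ^ 2 ≤ ∑ i : Fin d, ‖v‖ ^ 2 := Finset.sum_le_sum fun i _ => by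
            rw [← sq_abs, ← Real.norm_eq_abs]
            gcongr
            exact norm_le_pi_norm v i
        _ = _ := by simp
  · set s := p.toReal with hs
    have hs1 : 1 ≤ s := by
      have := ENNReal.toReal_mono htop hp
      simpa using this
    have hγ : gammaP p d = (d : ℝ) ^ |1 / 2 - 1 / s| := by
      rw [gammaP, ENNReal.toReal_inv, one_div s]
    rw [hγ]
    rcases le_total 2 s with h | h
    · refine ⟨1, one_pos, fun v => ?_⟩
      have : 1 / s ≤ 1 / 2 := one_div_le_one_div_of_le two_pos h
      rw [abs_of_nonneg (by linarith), ellNorm_eq_sum hp htop, sqrt_sum_sq_eq_rpow, one_mul, mul_one]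
      exact ⟨rpow_sum_antitone v two_pos h, rpow_sum_le_card_mul v two_pos h⟩
    · have hd' : (0 : ℝ) < d := by exact_mod_cast hd
      -- For `p ≤ 2` the `ℓ_p` norm is the larger one, so the scaling is `1 / γ_p`; for `p ≥ 2` it
      -- is `1`.
      refine ⟨((d : ℝ) ^ |1 / 2 - 1 / s|)⁻¹, by positivity, fun v => ?_⟩
      have : 1 / 2 ≤ 1 / s := one_div_le_one_div_of_le (by linarith) h
      rw [mul_inv_cancel₀ (by positivity), one_mul, inv_mul_le_iff₀ (by positivity), abs_sub_comm,
        abs_of_nonneg (by linarith), ellNorm_eq_sum hp htop, sqrt_sum_sq_eq_rpow]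
      exact ⟨rpow_sum_le_card_mul v (by linarith) h, rpow_sum_antitone v (by linarith) h⟩

end Norms

/-! ### Separation, radius and scale of a dataset -/

namespace Dataset

variable {d N C : ℕ}

theorem two_le_card (D : Dataset d N C) : 2 ≤ N := by
  obtain ⟨i, j, h⟩ := D.exists_ne
  have hij : i ≠ j := fun e => h (by rw [e])
  by_contra hN
  exact hij (Fin.ext (by have := i.2; have := j.2; lia))

theorem two_le_labels (D : Dataset d N C) : 2 ≤ C := by
  obtain ⟨i, j, h⟩ := D.exists_ne
  have := D.y_mem i
  have := D.y_mem j
  lia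

theorem dim_pos (D : Dataset d N C) : 0 < d := by
  obtain ⟨i, j, h⟩ := D.exists_ne
  rcases Nat.eq_zero_or_pos d with rfl | h0
  · exact absurd (D.x_injective (Subsingleton.elim (D.x i) (D.x j))) fun e => h (by rw [e])
  · exact h0

theorem ellNorm_nonneg {p : ℝ≥0∞} (hp : 1 ≤ p) (v : Fin d → ℝ) : 0 ≤ ellNorm p v := by
  have : Fact (1 ≤ p) := ⟨hp⟩
  exact norm_nonneg _

theorem two_mul_sep_le (D : Dataset d N C) {p : ℝ≥0∞} (hp : 1 ≤ p) {i j : Fin N} (h : D.y i ≠ D.y j) :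
    2 * D.sep p ≤ ellNorm p (D.x i - D.x j) := by
  have : sInf {r | ∃ i j, D.y i ≠ D.y j ∧ r = ellNorm p (D.x i - D.x j)} ≤
      ellNorm p (D.x i - D.x j) := by
    refine csInf_le ⟨0, ?_⟩ ⟨i, j, h, rfl⟩
    rintro r ⟨i, j, _, rfl⟩
    exact ellNorm_nonneg hp _
  rw [sep]
  linarith

theorem sep_pos (D : Dataset d N C) {p : ℝ≥0∞} (hp : 1 ≤ p) : 0 < D.sep p := by
  have : Fact (1 ≤ p) := ⟨hp⟩
  set S := {r | ∃ i j, D.y i ≠ D.y j ∧ r = ellNorm p (D.x i - D.x j)} with hS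
  have hfin : S.Finite := by
    refine (Set.finite_range fun q : Fin N × Fin N => ellNorm p (D.x q.1 - D.x q.2)).subset ?_
    rintro r ⟨i, j, _, rfl⟩
    exact ⟨(i, j), rfl⟩
  have hne : S.Nonempty := by
    obtain ⟨i, j, h⟩ := D.exists_ne
    exact ⟨_, i, j, h, rfl⟩
  obtain ⟨i, j, h, he⟩ := hne.csInf_mem hfin
  have hpos : 0 < ellNorm p (D.x i - D.x j) := by
    refine norm_pos_iff.2 fun h0 => ?_
    have h1 : D.x i - D.x j = 0 := (WithLp.toLp_eq_zero p).1 h0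
    exact h (by rw [D.x_injective (sub_eq_zero.1 h1)])
  rw [sep, ← hS, he]
  linarith

theorem ellNorm_le_radius (D : Dataset d N C) (p : ℝ≥0∞) (i : Fin N) : ellNorm p (D.x i) ≤ D.radius p :=
  le_ciSup (f := fun i => ellNorm p (D.x i)) (Set.finite_range _).bddAbove i

theorem sep_le_radius (D : Dataset d N C) {p : ℝ≥0∞} (hp : 1 ≤ p) : D.sep p ≤ D.radius p := by
  have : Fact (1 ≤ p) := ⟨hp⟩
  obtain ⟨i, j, h⟩ := D.exists_ne
  have h1 := D.two_mul_sep_le hp h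
  have h2 := D.ellNorm_le_radius p i
  have h3 := D.ellNorm_le_radius p j
  have h4 : ellNorm p (D.x i - D.x j) ≤ ellNorm p (D.x i) + ellNorm p (D.x j) := by
    simp only [ellNorm, WithLp.toLp_sub]
    exact norm_sub_le _ _
  linarith

theorem le_scale (D : Dataset d N C) {p : ℝ≥0∞} (hp : 1 ≤ p) :
    (N : ℝ) ≤ D.scale p ∧ (d : ℝ) ≤ D.scale p ∧ (C : ℝ) ≤ D.scale p ∧
      D.radius p / D.sep p ≤ D.scale p ∧ 1 ≤ D.radius p / D.sep p := by
  have hN : (1 : ℝ) ≤ N := by exact_mod_cast (one_le_two.trans D.two_le_card)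
  have hC : (1 : ℝ) ≤ C := by exact_mod_cast (one_le_two.trans D.two_le_labels)
  have hd : (1 : ℝ) ≤ d := by exact_mod_cast D.dim_pos
  have hq : 1 ≤ D.radius p / D.sep p := (one_le_div (D.sep_pos hp)).2 (D.sep_le_radius hp)
  rw [scale]
  set q := D.radius p / D.sep p
  have h1 : 1 ≤ (N : ℝ) * d := one_le_mul_of_one_le_of_one_le hN hd
  have h2 : 1 ≤ (N : ℝ) * d * C := one_le_mul_of_one_le_of_one_le h1 hC
  have hNd : (N : ℝ) ≤ N * d := le_mul_of_one_le_right (by positivity) hd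
  have hdN : (d : ℝ) ≤ N * d := le_mul_of_one_le_left (by positivity) hN
  have hNC : (N : ℝ) * d ≤ N * d * C := le_mul_of_one_le_right (by positivity) hC
  have hq' : (N : ℝ) * d * C ≤ N * d * C * q := le_mul_of_one_le_right (by positivity) hq
  have hCC : (C : ℝ) ≤ N * d * C := le_mul_of_one_le_left (by positivity) h1
  refine ⟨by linarith, by linarith, by linarith, ?_, hq⟩
  exact le_mul_of_one_le_left (by linarith) h2

/-- The data in Euclidean terms. -/
theorem exists_euclidean {p : ℝ≥0∞} (hp : 1 ≤ p) (D : Dataset d N C) :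
    ∃ ε R : ℝ, 0 < ε ∧ 0 ≤ R ∧ ε ≤ R ∧ R / ε ≤ D.scale p ^ 2 ∧
      (∀ i j, D.y i ≠ D.y j → 4 * ε ^ 2 ≤ ∑ t, (D.x i t - D.x j t) ^ 2) ∧
      (∀ i, ∑ t, D.x i t ^ 2 ≤ R ^ 2) ∧
      ∀ ρ, 0 ≤ ρ → ∀ i, ∀ z ∈ ellBall p (D.x i) (ρ * D.sep p),
        ∑ t, (z t - D.x i t) ^ 2 ≤ (ρ * gammaP p d * ε) ^ 2 := by
  obtain ⟨a, ha, hav⟩ := exists_scale_ellNorm hp D.dim_pos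
  have hγ := gammaP_pos (p := p) D.dim_pos
  have hγ1 := one_le_gammaP (p := p) D.dim_pos
  have hsep := D.sep_pos hp
  have hrad := D.sep_le_radius hp
  obtain ⟨-, hd, -, hR, hq⟩ := D.le_scale hp
  have hsq : ∀ (v : Fin d → ℝ) (b : ℝ), √(∑ i, v i ^ 2) ≤ b → ∑ i, v i ^ 2 ≤ b ^ 2 := fun v b h =>
    (Real.sqrt_le_left ((Real.sqrt_nonneg _).trans h)).1 h
  -- The scaling `a` cancels in `R / ε`, which costs only a factor `γ_p ≤ d`, hence the square of
  -- the scale.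
  refine ⟨a * D.sep p, gammaP p d * a * D.radius p, by positivity, ?_, ?_, ?_, fun i j h => ?_,
    fun i => ?_, fun ρ hρ i z hz => ?_⟩
  · have := hsep.le.trans hrad
    positivity
  · calc a * D.sep p ≤ 1 * a * D.radius p := by rw [one_mul]; gcongr
      _ ≤ _ := by
        have := hsep.le.trans hrad
        gcongr
  · have e : gammaP p d * a * D.radius p / (a * D.sep p) =
        gammaP p d * (D.radius p / D.sep p) := by field_simp
    rw [e, sq]
    have := (gammaP_le hp D.dim_pos).trans hd
    have : 0 ≤ D.scale p := by linarith
    gcongr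
  · have h1 := (hav (D.x i - D.x j)).1
    have h2 := D.two_mul_sep_le hp h
    have h3 : 2 * (a * D.sep p) ≤ √(∑ t, (D.x i t - D.x j t) ^ 2) := by
      refine le_trans ?_ h1
      nlinarith
    have := (Real.le_sqrt (by positivity) (Finset.sum_nonneg fun _ _ => sq_nonneg _)).1 h3
    linarith
  · refine hsq _ _ ((hav (D.x i)).2.trans ?_)
    gcongr
    exact D.ellNorm_le_radius p i
  · refine hsq (fun t => z t - D.x i t) _ ((hav (z - D.x i)).2.trans ?_)
    have h1 : ellNorm p (z - D.x i) ≤ ρ * D.sep p := le_of_lt hz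
    calc _ ≤ gammaP p d * a * (ρ * D.sep p) := by gcongr
      _ = _ := by ring

end Dataset

/-! ### Parameter counts -/

section Counts

theorem exists_lt_two_pow {X : ℝ} (hX : 1 ≤ X) : ∃ n : ℕ, X < 2 ^ n ∧ (n : ℝ) ≤ 2 * Real.log X + 1 := by
  have hl : 0 ≤ Real.log X := Real.log_nonneg hX
  have h2 := Real.log_two_gt_d9
  refine ⟨⌊2 * Real.log X⌋₊ + 1, ?_, ?_⟩
  · have h1 := Nat.lt_floor_add_one (2 * Real.log X)
    rw [← Real.log_lt_log_iff (by linarith) (by positivity), Real.log_pow]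
    push_cast
    nlinarith
  · push_cast
    have := Nat.floor_le (by linarith : 0 ≤ 2 * Real.log X)
    linarith

theorem signCount_le {N : ℕ} {S : ℝ} (hN : 0 < N) (hS : (N : ℝ) ≤ S) :
    (signCount N : ℝ) ≤ 16 * (1 + Real.log S) := by
  have h1 : (1 : ℝ) ≤ N := by exact_mod_cast hN
  have h2 : Real.log N ≤ Real.log S := Real.log_le_log (by linarith) hS
  have h3 := Nat.floor_le (by have := Real.log_nonneg h1; linarith : 0 ≤ 16 * Real.log N)
  rw [signCount]
  push_cast
  linarith

/-- The powers of `Λ` arise from keys of about `nb * L` bits (two) and from the squared number of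
registers (two). -/
theorem cell_count_le {d L nb cb G s : ℕ} {Λ : ℝ} (hΛ : 1 ≤ Λ) (hd : 0 < d) (hs : 0 < s)
    (hL : (L : ℝ) ≤ 16 * Λ) (hnb : (nb : ℝ) ≤ 12 * Λ) (hcb : (cb : ℝ) ≤ 4 * Λ) :
    (((d + 2) * (L + 9) + 2 * (G * (L * (4 * nb + 2) +
      (s + 1 + s * (4 * (nb * L + cb) + 2)) + 3)) * (L + 12) ^ 2 : ℕ) : ℝ) ≤
      2600000 * (G * s + d) * Λ ^ 4 := by
  have hd1 : (1 : ℝ) ≤ d := by exact_mod_cast hd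
  have hs1 : (1 : ℝ) ≤ s := by exact_mod_cast hs
  have hΛ2 : Λ ≤ Λ ^ 2 := by nlinarith
  have hΛ4 : Λ ≤ Λ ^ 4 := le_self_pow₀ hΛ (by norm_num)
  push_cast
  have h1 : ((d : ℝ) + 2) * (L + 9) ≤ (3 * d) * (25 * Λ) := by
    gcongr <;> linarith
  have h2 : (L : ℝ) * (4 * nb + 2) ≤ 16 * Λ * (50 * Λ) := by
    gcongr; linarith
  have h3 : (nb : ℝ) * L ≤ 12 * Λ * (16 * Λ) := by gcongr
  have h4 : (4 : ℝ) * (nb * L + cb) + 2 ≤ 786 * Λ ^ 2 := by nlinarith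
  have h5 : (L : ℝ) * (4 * nb + 2) + (s + 1 + s * (4 * (nb * L + cb) + 2)) + 3 ≤
      1600 * (s * Λ ^ 2) := by
    have h6 : (s : ℝ) * (4 * (nb * L + cb) + 2) ≤ s * (786 * Λ ^ 2) := by gcongr
    have h7 : Λ ^ 2 ≤ s * Λ ^ 2 := le_mul_of_one_le_left (by positivity) hs1
    have h8 : (s : ℝ) ≤ s * Λ ^ 2 := le_mul_of_one_le_right (by positivity) (by linarith)
    nlinarith
  have h9 : ((L : ℝ) + 12) ^ 2 ≤ (28 * Λ) ^ 2 := by gcongr; linarith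
  calc _ ≤ (3 * d) * (25 * Λ) + 2 * (G * (1600 * (s * Λ ^ 2))) * (28 * Λ) ^ 2 := by gcongr
    _ = 75 * d * Λ + 2508800 * (G * s) * Λ ^ 4 := by ring
    _ ≤ 75 * d * Λ ^ 4 + 2508800 * (G * s) * Λ ^ 4 := by gcongr
    _ ≤ _ := by
      have h10 : (0 : ℝ) ≤ G * s * Λ ^ 4 := by positivity
      have h11 : (0 : ℝ) ≤ d * Λ ^ 4 := by positivity
      nlinarith

/-- Three terms compete: `d W` from the input layer, `N W ^ 2` from the tents, and `W ^ 3` from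
squaring, absorbed by `W ≲ N` up to logarithms. -/
theorem ball_count_le {d N W l : ℕ} {Λ ρ : ℝ} (hΛ : 1 ≤ Λ) (hd : 0 < d) (hN : 0 < N)
    (hρ1 : ρ ≤ 1) (hρ0 : 0 < ρ) (hρd : 1 ≤ 25 * d * ρ ^ 2)
    (hW : (W : ℝ) ≤ 5888 * Λ ^ 2 * (min (N : ℝ) d * ρ ^ 2 + 1)) (hl : (l : ℝ) ≤ 64 * Λ) :
    (((d + 2) * (W + 6) + 2 * (W * (l * 2 + 2) + N * 2) * (W + 9) ^ 2 : ℕ) : ℝ) ≤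
      10 ^ 18 * (N * (d : ℝ) ^ 2 * ρ ^ 4 + d) * Λ ^ 7 := by
  have hd1 : (1 : ℝ) ≤ d := by exact_mod_cast hd
  have hN1 : (1 : ℝ) ≤ N := by exact_mod_cast hN
  set m := min (N : ℝ) d with hm
  have hm0 : 0 ≤ m := le_min (by positivity) (by positivity)
  have hmN : m ≤ N := min_le_left _ _
  have hmd : m ≤ d := min_le_right _ _
  set X := m * ρ ^ 2 + 1 with hX
  have hX1 : 1 ≤ X := by rw [hX]; nlinarith [mul_nonneg hm0 (sq_nonneg ρ)]
  have hρ2 : ρ ^ 2 ≤ 1 := by nlinarith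
  have hXN : X ≤ 2 * N := by
    have : m * ρ ^ 2 ≤ m * 1 := by gcongr
    rw [hX]; linarith
  set a := (N : ℝ) * (d : ℝ) ^ 2 * ρ ^ 4 with ha
  have ha0 : 0 ≤ a := by positivity
  have hΛ2 : 1 ≤ Λ ^ 2 := one_le_pow₀ hΛ
  have hΛX : 1 ≤ Λ ^ 2 * X := one_le_mul_of_one_le_of_one_le hΛ2 hX1
  -- The input layer is paid by a geometric mean: `(d m ρ ^ 2) ^ 2 ≤ a d`, where both sides of the
  -- minimum `m` are used.
  have hdX : d * X ≤ 2 * (a + d) := by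
    have h1 : d * (m * ρ ^ 2) ≤ a + d := by
      refine abs_le_of_sq_le_sq' ?_ (by positivity) |>.2
      have h2 : m * m ≤ N * d := by gcongr
      calc (d * (m * ρ ^ 2)) ^ 2 = m * m * (d ^ 2 * ρ ^ 4) := by ring
        _ ≤ N * d * (d ^ 2 * ρ ^ 4) := by gcongr
        _ = a * d := by rw [ha]; ring
        _ ≤ (a + d) ^ 2 := by nlinarith [mul_nonneg ha0 (by positivity : (0 : ℝ) ≤ d)]
    rw [hX]; linarith
  have hNa : N ≤ 625 * a := by
    have h1 : 1 ≤ (25 * d * ρ ^ 2) ^ 2 := one_le_pow₀ hρd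
    calc (N : ℝ) = N * 1 := by ring
      _ ≤ N * (25 * d * ρ ^ 2) ^ 2 := by gcongr
      _ = 625 * a := by rw [ha]; ring
  have hNX : N * X ^ 2 ≤ 1252 * a := by
    have h1 : X ^ 2 ≤ 2 * (m ^ 2 * ρ ^ 4) + 2 := by
      rw [hX]; nlinarith [sq_nonneg (m * ρ ^ 2 - 1)]
    have h2 : m ^ 2 * ρ ^ 4 ≤ d ^ 2 * ρ ^ 4 := by gcongr
    calc N * X ^ 2 ≤ N * (2 * (d ^ 2 * ρ ^ 4) + 2) := by gcongr; linarith
      _ = 2 * a + 2 * N := by rw [ha]; ring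
      _ ≤ _ := by linarith
  have hW9 : (W : ℝ) + 9 ≤ 5900 * (Λ ^ 2 * X) := by linarith
  have hT : (W : ℝ) * (l * 2 + 2) + N * 2 ≤ 1600000 * (N * Λ ^ 3) := by
    have h1 : (W : ℝ) * (l * 2 + 2) ≤ (5888 * Λ ^ 2 * (2 * N)) * (130 * Λ) := by
      gcongr
      · refine hW.trans ?_
        gcongr
      · linarith
    have h2 : (N : ℝ) ≤ N * Λ ^ 3 := le_mul_of_one_le_right (by positivity) (one_le_pow₀ hΛ)
    nlinarith
  push_cast
  calc _ ≤ (3 * d) * (5900 * (Λ ^ 2 * X)) + 2 * (1600000 * (N * Λ ^ 3)) * (5900 * (Λ ^ 2 * X)) ^ 2 := by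
        gcongr <;> linarith
    _ = 17700 * (d * X) * Λ ^ 2 + 111392000000000 * (N * X ^ 2) * Λ ^ 7 := by ring
    _ ≤ 17700 * (2 * (a + d)) * Λ ^ 7 + 111392000000000 * (1252 * a) * Λ ^ 7 := by
        gcongr
        norm_num
    _ ≤ _ := by
        have h1 : 0 ≤ a * Λ ^ 7 := by positivity
        have h2 : 0 ≤ (d : ℝ) * Λ ^ 7 := by positivity
        nlinarith

end Counts

/-! ### The main theorem -/

section Main

theorem IsAff.measurable {d : ℕ} {f : (Fin d → ℝ) → ℝ} (hf : IsAff f) : Measurable f := by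
  obtain ⟨w, b, h⟩ := hf
  have : f = fun a => ∑ j, w j * a j + b := funext h
  rw [this]
  fun_prop

/-- Thin zones below the integers have small measure. -/
theorem exists_thin_zone {d N G L : ℕ} {u : ℕ → ℕ → (Fin d → ℝ) → ℝ} (hu : ∀ g k, Measurable (u g k))
    (ν : Fin N → Measure (Fin d → ℝ)) [∀ i, IsFiniteMeasure (ν i)] {η : ℝ} (hη : 0 < η) :
    ∃ δ : ℝ, 0 < δ ∧ ∀ i,
      ν i {z | ∃ g < G, ∃ k < L, 1 - δ < Int.fract (u g k z)} ≤ ENNReal.ofReal η := by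
  let bad : ℕ → Set (Fin d → ℝ) := fun n =>
    {z | ∃ g < G, ∃ k < L, 1 - 1 / ((n : ℝ) + 1) < Int.fract (u g k z)}
  have hmeas : ∀ n, MeasurableSet (bad n) := by
    intro n
    have : bad n = ⋃ g ∈ Finset.range G, ⋃ k ∈ Finset.range L,
        {z | 1 - 1 / ((n : ℝ) + 1) < Int.fract (u g k z)} := by
      ext z; simp [bad]
    rw [this]
    exact Finset.measurableSet_biUnion _ fun g _ => Finset.measurableSet_biUnion _ fun k _ =>
      measurableSet_lt measurable_const (measurable_fract.comp (hu g k))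
  have hanti : Antitone bad := by
    rintro n n' h z ⟨g, hg, k, hk, hz⟩
    refine ⟨g, hg, k, hk, lt_of_le_of_lt ?_ hz⟩
    have : 1 / ((n' : ℝ) + 1) ≤ 1 / ((n : ℝ) + 1) := by gcongr
    linarith
  -- Fractional parts are strictly below `1`, so the zones shrink to nothing and continuity from
  -- above applies.
  have hempty : ⋂ n, bad n = ∅ := by
    refine Set.eq_empty_iff_forall_notMem.2 fun z hz => ?_
    have hz' : ∀ n, z ∈ bad n := Set.mem_iInter.1 hz
    have hall : ∀ g k : ℕ, ∃ n₀ : ℕ, ∀ n ≥ n₀, ¬ 1 - 1 / ((n : ℝ) + 1) < Int.fract (u g k z) := by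
      intro g k
      have h1 : 0 < 1 - Int.fract (u g k z) := by linarith [Int.fract_lt_one (u g k z)]
      obtain ⟨n₀, hn₀⟩ := exists_nat_one_div_lt h1
      refine ⟨n₀, fun n hn => ?_⟩
      have : 1 / ((n : ℝ) + 1) ≤ 1 / ((n₀ : ℝ) + 1) := by gcongr
      linarith
    choose n₀ hn₀ using hall
    obtain ⟨g, hg, k, hk, h⟩ := hz' (∑ g ∈ Finset.range G, ∑ k ∈ Finset.range L, n₀ g k)
    refine hn₀ g k _ ?_ h
    calc n₀ g k ≤ ∑ k ∈ Finset.range L, n₀ g k :=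
          Finset.single_le_sum (f := fun k => n₀ g k) (fun _ _ => Nat.zero_le _) (Finset.mem_range.2 hk)
      _ ≤ _ := Finset.single_le_sum (f := fun g => ∑ k ∈ Finset.range L, n₀ g k)
          (fun _ _ => Nat.zero_le _) (Finset.mem_range.2 hg)
  have hev : ∀ i, ∀ᶠ n in Filter.atTop, ν i (bad n) ≤ ENNReal.ofReal η := by
    intro i
    have h := tendsto_measure_iInter_atTop (μ := ν i) (fun n => (hmeas n).nullMeasurableSet) hanti
      ⟨0, measure_ne_top _ _⟩
    rw [hempty, measure_empty] at h
    exact h.eventually_le_const (ENNReal.ofReal_pos.2 hη)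
  obtain ⟨n, hn⟩ := (Filter.eventually_all.2 hev).exists
  exact ⟨1 / ((n : ℝ) + 1), by positivity, hn⟩

theorem measurableSet_ellBall {p : ℝ≥0∞} (hp : 1 ≤ p) {d : ℕ} (c : Fin d → ℝ) (r : ℝ) :
    MeasurableSet (ellBall p c r) := by
  have : Fact (1 ≤ p) := ⟨hp⟩
  have hcont : Continuous fun z : Fin d → ℝ => ellNorm p (z - c) := by
    simp only [ellNorm]
    exact ((PiLp.continuous_toLp p _).comp (continuous_id.sub continuous_const)).norm
  exact (isOpen_lt hcont continuous_const).measurableSet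

theorem sqrt_le_self_of_one_le {x : ℝ} (hx : 1 ≤ x) : √x ≤ x := by
  rw [Real.sqrt_le_left (by linarith)]
  nlinarith

theorem exists_sqrt_ceil {n : ℕ} (hn : 0 < n) : ∃ s : ℕ, 0 < s ∧ n ≤ s * s ∧ (s : ℝ) ≤ 2 * √n := by
  refine ⟨Nat.sqrt n + 1, Nat.succ_pos _, (Nat.lt_succ_sqrt n).le, ?_⟩
  have h1 : (Nat.sqrt n : ℝ) ≤ √n := Real.nat_sqrt_le_real_sqrt
  have h2 : 1 ≤ √(n : ℝ) := Real.one_le_sqrt.2 (by exact_mod_cast hn)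
  push_cast
  linarith

/-! ### The three ranges of the robustness ratio -/

namespace Dataset

variable {d N C : ℕ}

/-- Networks from grid cells, with `G` groups of at most `n` points. -/
theorem exists_cell_net {p : ℝ≥0∞} (hp : 1 ≤ p) (D : Dataset d N C) {ρ : ℝ} (hρ : 0 ≤ ρ)
    {n G : ℕ} (hn : 0 < n) (hnρ : 5 * n * √d * (ρ * gammaP p d) ≤ 1) (grp : Fin N → ℕ)
    (hgrp : ∀ i, grp i < G) (hfib : ∀ g, (Finset.univ.filter fun i => grp i = g).card ≤ n) :
    ∃ (u : ℕ → ℕ → (Fin d → ℝ) → ℝ) (L : ℕ), (∀ g k, IsAff (u g k)) ∧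
      (∀ i, ∀ z ∈ ellBall p (D.x i) (ρ * D.sep p), ∀ k,
        Int.fract (u (grp i) k z) ≤ 1 - (1 / (2 * ((n : ℝ) + 1)) - 1 / (5 * n))) ∧
      ∀ δ : ℝ, 0 < δ → ∃ net : ReLUNet d,
        (net.numParams : ℝ) ≤ 5200000 * (G * √n + d) * (1 + Real.log (D.scale p)) ^ 4 ∧
        ∀ i, ∀ z ∈ ellBall p (D.x i) (ρ * D.sep p),
          (∀ g < G, ∀ k < L, Int.fract (u g k z) ≤ 1 - δ) → net.eval z = D.y i := by
  obtain ⟨ε, R, hε, hR, hεR, hRε, hsep, hxR, hball⟩ := D.exists_euclidean hp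
  obtain ⟨hSN, hSd, hSC, -, -⟩ := D.le_scale hp
  have hN2 : (2 : ℝ) ≤ N := by exact_mod_cast D.two_le_card
  have hN : 0 < N := by have := D.two_le_card; lia
  have hd : 0 < d := D.dim_pos
  have hd1 : (1 : ℝ) ≤ d := by exact_mod_cast hd
  set S := D.scale p with hS
  have hS2 : 2 ≤ S := hN2.trans hSN
  have hlog : 0 ≤ Real.log S := Real.log_nonneg (by linarith)
  -- The exponents are ample: projections are bounded by a multiple of `S ^ 3`, labels by `S`, and
  -- `S ≥ 2` absorbs the constants.
  obtain ⟨nb, hnb, hnb'⟩ := exists_lt_two_pow (X := S ^ 6) (one_le_pow₀ (by linarith))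
  obtain ⟨cb, hcb, hcb'⟩ := exists_lt_two_pow (X := S ^ 2) (one_le_pow₀ (by linarith))
  rw [Real.log_pow] at hnb' hcb'
  push_cast at hnb' hcb'
  obtain ⟨s, hs0, hs, hs'⟩ := exists_sqrt_ceil hn
  have hγ := gammaP_pos (p := p) hd
  have hsd : 1 ≤ √(d : ℝ) := Real.one_le_sqrt.2 hd1
  have hn1 : (1 : ℝ) ≤ n := by exact_mod_cast hn
  have hρ0 : 0 ≤ ρ * gammaP p d := by positivity
  have hr1 : ρ * gammaP p d ≤ 1 := by
    have h1 : 1 ≤ (n : ℝ) * √d := one_le_mul_of_one_le_of_one_le hn1 hsd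
    refine (le_mul_of_one_le_left hρ0 ?_).trans hnρ
    linarith
  have hbits : 2 * (√d * (R + ε) / ε) + 1 < 2 ^ nb := by
    refine lt_of_le_of_lt ?_ hnb
    have h1 : (R + ε) / ε ≤ 2 * S ^ 2 := by
      rw [add_div, div_self hε.ne']
      have := one_le_pow₀ (by linarith : 1 ≤ S) (n := 2)
      linarith
    have h2 : √(d : ℝ) ≤ S := (sqrt_le_self_of_one_le hd1).trans hSd
    have h3 : √d * (R + ε) / ε ≤ S * (2 * S ^ 2) := by
      rw [mul_div_assoc]
      gcongr
    have h4 := mul_le_mul_of_nonneg_right (pow_le_pow_left₀ zero_le_two hS2 3)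
      (pow_nonneg (by linarith : 0 ≤ S) 3)
    have h5 : (2 : ℝ) ^ 3 ≤ S ^ 3 := pow_le_pow_left₀ zero_le_two hS2 3
    have h6 : S ^ 3 * S ^ 3 = S ^ 6 := by ring
    linarith
  have hlab : C + 1 ≤ 2 ^ cb := by
    have : ((C + 1 : ℕ) : ℝ) ≤ ((2 ^ cb : ℕ) : ℝ) := by
      push_cast
      nlinarith
    exact_mod_cast this
  obtain ⟨u, hu, hu1, hu2⟩ := _root_.exists_cell_net (C := C) (G := G) (n := n) (s := s) (nb := nb)
    (cb := cb) (x := D.x) (y := D.y) (ε := ε) (R := R) (r := ρ * gammaP p d * ε) hN hε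
    (by positivity) hR (mul_le_of_le_one_left hε.le hr1) (fun i => (D.y_mem i).2) hsep hxR hn
    (by have := mul_le_mul_of_nonneg_right hnρ hε.le; linarith) grp hgrp
    hfib hs hs0 hbits hlab
  refine ⟨u, signCount N, hu, fun i z hz => hu1 i z (hball ρ hρ i z hz), fun δ hδ => ?_⟩
  obtain ⟨net, hnet, hev⟩ := hu2 δ hδ
  refine ⟨net, ?_, fun i z hz => hev i z (hball ρ hρ i z hz)⟩
  have hcount := cell_count_le (G := G) (Λ := 1 + Real.log S) (by linarith) hd hs0
    (signCount_le hN hSN) (nb := nb) (cb := cb) (by linarith) (by linarith)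
  refine ((Nat.cast_le (α := ℝ)).2 hnet).trans (hcount.trans ?_)
  refine mul_le_mul_of_nonneg_right ?_ (pow_nonneg (by linarith) 4)
  have hGs := mul_le_mul_of_nonneg_left hs' (Nat.cast_nonneg (α := ℝ) G)
  linarith

theorem exists_net_of_small {p : ℝ≥0∞} (hp : 1 ≤ p) (D : Dataset d N C) {ρ : ℝ} (hρ : 0 < ρ)
    (hρ1 : ρ ≤ 1 / (5 * N * √(d : ℝ) * gammaP p d)) :
    ∃ net : ReLUNet d,
      (net.numParams : ℝ) ≤ 5200000 * (√(N : ℝ) + d) * (1 + Real.log (D.scale p)) ^ 4 ∧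
      D.RobustlyMemorizes p ρ net.eval := by
  have hN : 0 < N := by have := D.two_le_card; lia
  have hN' : (0 : ℝ) < N := by exact_mod_cast hN
  have hd : (0 : ℝ) < d := by exact_mod_cast D.dim_pos
  have hγ := gammaP_pos (p := p) D.dim_pos
  obtain ⟨u, L, -, hu1, hu2⟩ := D.exists_cell_net hp hρ.le (n := N) (G := 1) hN (by
    rw [le_div_iff₀ (by positivity)] at hρ1
    linarith) (fun _ => 0) (fun _ => one_pos) (fun g => by
    simpa using Finset.card_filter_le (Finset.univ : Finset (Fin N)) (fun _ => 0 = g))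
  -- With a single group every ball avoids the zones of the only grid, so its own margin serves as
  -- `δ` and there is no error.
  have hδ : 0 < 1 / (2 * ((N : ℝ) + 1)) - 1 / (5 * N) := by
    have h1 : (1 : ℝ) ≤ N := by exact_mod_cast hN
    have : 1 / (5 * (N : ℝ)) < 1 / (2 * ((N : ℝ) + 1)) := by
      apply one_div_lt_one_div_of_lt <;> linarith
    linarith
  obtain ⟨net, hnet, hev⟩ := hu2 _ hδ
  refine ⟨net, by simpa using hnet, fun i z hz => hev i z hz fun g hg k _ => ?_⟩
  obtain rfl : g = 0 := by lia
  exact hu1 i z hz k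

theorem exists_net_of_moderate {p : ℝ≥0∞} (hp : 1 ≤ p) (D : Dataset d N C) {ρ η : ℝ}
    (hρ : 1 / (5 * N * √(d : ℝ) * gammaP p d) < ρ) (hρ1 : ρ ≤ 1 / (5 * √(d : ℝ) * gammaP p d))
    (hη : 0 < η) :
    ∃ net : ReLUNet d,
      (net.numParams : ℝ) ≤ 52000000 * (N * (d : ℝ) ^ (1 / 4 : ℝ) * ρ ^ (1 / 2 : ℝ)
        * gammaP p d ^ (1 / 2 : ℝ) + d) * (1 + Real.log (D.scale p)) ^ 4 ∧
      D.robustError p ρ net.eval ≤ ENNReal.ofReal η := by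
  have hN : 0 < N := by have := D.two_le_card; lia
  have hN' : (0 : ℝ) < N := by exact_mod_cast hN
  have hd : (0 : ℝ) < d := by exact_mod_cast D.dim_pos
  have hγ := gammaP_pos (p := p) D.dim_pos
  have hsd : 0 < √(d : ℝ) := Real.sqrt_pos.2 hd
  have hρ0 : 0 < ρ := lt_trans (by positivity) hρ
  have hS : 1 ≤ D.scale p := by
    have h := (D.le_scale hp).1
    have : (1 : ℝ) ≤ N := by exact_mod_cast hN
    linarith
  have hlog := Real.log_nonneg hS
  set Q := √(d : ℝ) * (ρ * gammaP p d) with hQ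
  have hQ0 : 0 < Q := by positivity
  rw [div_lt_iff₀ (by positivity)] at hρ
  rw [le_div_iff₀ (by positivity)] at hρ1
  have hQ1 : 5 * Q ≤ 1 := by rw [hQ]; linarith
  have hQN : 1 < 5 * Q * N := by rw [hQ]; linarith
  -- The largest group size for which a shift protects all balls of a group.
  set n := ⌊1 / (5 * Q)⌋₊ with hn
  have hn1 : 1 ≤ n := by
    rw [hn, Nat.one_le_floor_iff, le_div_iff₀ (by positivity)]
    linarith
  have hnR : (1 : ℝ) ≤ n := by exact_mod_cast hn1
  have hnle : (n : ℝ) ≤ 1 / (5 * Q) := Nat.floor_le (by positivity)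
  have hnge : 1 / (5 * Q) < n + 1 := Nat.lt_floor_add_one _
  have hnN : (n : ℝ) ≤ N := hnle.trans (by
    rw [div_le_iff₀ (by positivity)]
    linarith)
  rw [le_div_iff₀ (by positivity)] at hnle
  rw [div_lt_iff₀ (by positivity)] at hnge
  obtain ⟨u, L, hu, hu1, hu2⟩ := D.exists_cell_net hp hρ0.le (n := n) (G := N / n + 1) hn1 (by
    rw [hQ] at hnle
    linarith) (fun i => i / n) (fun i => Nat.lt_succ_of_le (Nat.div_le_div_right i.2.le))
    (card_filter_div_le hn1)
  obtain ⟨δ, hδ, hbad⟩ := exists_thin_zone (G := N / n + 1) (L := L) (fun g k => (hu g k).measurable)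
    (fun i => ProbabilityTheory.cond (volume : Measure (Fin d → ℝ))
      (ellBall p (D.x i) (ρ * D.sep p))) hη
  obtain ⟨net, hnet, hev⟩ := hu2 δ hδ
  refine ⟨net, hnet.trans ?_, ?_⟩
  · have hG : ((N / n + 1 : ℕ) : ℝ) ≤ 2 * (N / n) := by
      have h1 : ((N / n : ℕ) : ℝ) ≤ N / n := Nat.cast_div_le
      have h2 : 1 ≤ (N : ℝ) / n := (one_le_div (by linarith)).2 hnN
      push_cast
      linarith
    have hroot : (N : ℝ) * (d : ℝ) ^ (1 / 4 : ℝ) * ρ ^ (1 / 2 : ℝ) * gammaP p d ^ (1 / 2 : ℝ) =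
        N * √Q := by
      have h1 : (d : ℝ) ^ (1 / 4 : ℝ) = √(√(d : ℝ)) := by
        rw [Real.sqrt_eq_rpow, Real.sqrt_eq_rpow, ← Real.rpow_mul hd.le]
        norm_num
      rw [h1, ← Real.sqrt_eq_rpow, ← Real.sqrt_eq_rpow, hQ, Real.sqrt_mul (by positivity),
        Real.sqrt_mul hρ0.le]
      ring
    have hsn : 0 < √(n : ℝ) := Real.sqrt_pos.2 (by linarith)
    -- From `1 < 5 Q (n + 1) ≤ 10 Q n`; it converts `N / √n` into `N √Q`.
    have hinv : 1 ≤ 4 * √Q * √n := by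
      have h1 : 1 ≤ √(16 * (Q * n)) := Real.one_le_sqrt.2 (by nlinarith)
      rw [Real.sqrt_mul (by norm_num), Real.sqrt_mul hQ0.le] at h1
      have h2 : √(16 : ℝ) = 4 := by
        rw [show (16 : ℝ) = 4 ^ 2 by norm_num, Real.sqrt_sq (by norm_num)]
      rw [h2] at h1
      linarith
    have hGn : ((N / n + 1 : ℕ) : ℝ) * √n ≤ 8 * (N * √Q) := by
      calc ((N / n + 1 : ℕ) : ℝ) * √n ≤ 2 * (N / n) * √n := by gcongr
        _ = 2 * N / √n := by
          have h1 : √(n : ℝ) * √n = n := Real.mul_self_sqrt (by linarith)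
          rw [eq_div_iff hsn.ne', mul_assoc, h1]
          field_simp
        _ ≤ 8 * (N * √Q) := by
          rw [div_le_iff₀ hsn]
          nlinarith
    rw [hroot]
    gcongr ?_ * _
    have : 0 ≤ N * √Q := by positivity
    linarith
  · refine iSup_le fun i => (hbad i).trans' ?_
    set ν := ProbabilityTheory.cond (volume : Measure (Fin d → ℝ))
      (ellBall p (D.x i) (ρ * D.sep p)) with hν
    have hms := measurableSet_ellBall hp (D.x i) (ρ * D.sep p)
    -- The conditional measure ignores the complement of the ball, where the network is
    -- uncontrolled.
    have hzero : ν (ellBall p (D.x i) (ρ * D.sep p))ᶜ = 0 := by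
      rw [hν, ProbabilityTheory.cond_apply hms]
      simp
    calc ν {z | net.eval z ≠ D.y i} ≤ ν ({z | ∃ g < N / n + 1, ∃ k < L,
          1 - δ < Int.fract (u g k z)} ∪ (ellBall p (D.x i) (ρ * D.sep p))ᶜ) := by
          refine measure_mono fun z hz => ?_
          by_contra hcon
          simp only [Set.mem_union, Set.mem_ofPred_eq, Set.mem_compl_iff, not_or, not_not, not_exists,
            not_and, not_lt] at hcon
          exact hz (hev i z hcon.2 hcon.1)
      _ ≤ _ := (measure_union_le _ _).trans (by rw [hzero, add_zero])

/-- The number of squaring steps: a precision polynomial in `S` and `1 / (1 - τ)` needs only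
logarithmically many. -/
theorem sq_mul_div_four_pow_le {S S' M W τ : ℝ} {l : ℕ} (hS2 : 2 ≤ S) (hSS' : S ≤ S')
    (h1τ : 0 < 1 - τ) (hinv : 1 / (1 - τ) ≤ S') (hM0 : 0 ≤ M) (hM : M ≤ S ^ 6) (hW0 : 0 ≤ W)
    (hW : W ≤ 11776 * S ^ 3) (hl : S' ^ 32 < 2 ^ l) : 4 * M ^ 2 * (W / 4 ^ l) ≤ 1 - τ := by
  have hS0 : 0 ≤ S := by linarith
  have hS'0 : 0 ≤ S' := by linarith
  have h1 : 4 * M ^ 2 * W ≤ 47104 * S' ^ 15 := by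
    calc 4 * M ^ 2 * W ≤ 4 * (S ^ 6) ^ 2 * (11776 * S ^ 3) := by gcongr
      _ = 47104 * S ^ 15 := by ring
      _ ≤ _ := by gcongr
  have h2 : (2 : ℝ) ^ l ≤ 4 ^ l := by gcongr; norm_num
  have h3 : 4 * M ^ 2 * W * (1 / (1 - τ)) ≤ 4 ^ l := by
    calc _ ≤ 47104 * S' ^ 15 * S' := by gcongr
      _ ≤ 2 ^ 16 * S' ^ 16 := by
        have : 0 ≤ S' ^ 16 := by positivity
        linarith
      _ ≤ S' ^ 16 * S' ^ 16 := by gcongr; linarith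
      _ = S' ^ 32 := by ring
      _ ≤ 4 ^ l := hl.le.trans h2
  rw [mul_one_div, div_le_iff₀ h1τ] at h3
  rw [← mul_div_assoc, div_le_iff₀ (by positivity)]
  linarith

theorem exists_net_of_large {p : ℝ≥0∞} (hp : 1 ≤ p) (D : Dataset d N C) {ρ : ℝ}
    (hρ : 1 / (5 * √(d : ℝ) * gammaP p d) < ρ) (hρ1 : ρ < 1 / gammaP p d) :
    ∃ net : ReLUNet d,
      (net.numParams : ℝ) ≤ 10 ^ 18 * (N * (d : ℝ) ^ 2 * ρ ^ 4 * gammaP p d ^ 4 + d)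
        * (1 + Real.log (D.scale p / (1 - ρ * gammaP p d))) ^ 7 ∧
      D.RobustlyMemorizes p ρ net.eval := by
  obtain ⟨ε, R, hε, hR, hεR, hRε, hsep, hxR, hball⟩ := D.exists_euclidean hp
  obtain ⟨hSN, hSd, -, -, -⟩ := D.le_scale hp
  have hN : 0 < N := by have := D.two_le_card; lia
  have hN2 : (2 : ℝ) ≤ N := by exact_mod_cast D.two_le_card
  have hd : (0 : ℝ) < d := by exact_mod_cast D.dim_pos
  have hd1 : (1 : ℝ) ≤ d := by exact_mod_cast D.dim_pos
  have hγ := gammaP_pos (p := p) D.dim_pos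
  have hsd : 0 < √(d : ℝ) := Real.sqrt_pos.2 hd
  have hρ0 : 0 < ρ := lt_trans (by positivity) hρ
  rw [div_lt_iff₀ (by positivity)] at hρ
  rw [lt_div_iff₀ hγ] at hρ1
  have hpow : (N : ℝ) * (d : ℝ) ^ 2 * ρ ^ 4 * gammaP p d ^ 4 =
      N * (d : ℝ) ^ 2 * (ρ * gammaP p d) ^ 4 := by ring
  rw [hpow]
  set τ := ρ * gammaP p d with hτ
  have hτ0 : 0 < τ := by positivity
  have hτd : 1 < 5 * √(d : ℝ) * τ := by rw [hτ]; linarith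
  set S := D.scale p with hS
  have hS2 : 2 ≤ S := hN2.trans hSN
  set S' := S / (1 - τ) with hS'
  have h1τ : 0 < 1 - τ := by linarith
  have hSS' : S ≤ S' := by
    rw [hS', le_div_iff₀ h1τ]
    nlinarith
  have hinv : 1 / (1 - τ) ≤ S' := by
    rw [hS']; gcongr; linarith
  have hlogS : 0 ≤ Real.log S := Real.log_nonneg (by linarith)
  have hlog : 0 ≤ Real.log S' := Real.log_nonneg (by linarith)
  have hlogle : Real.log S ≤ Real.log S' := Real.log_le_log (by linarith) hSS'
  obtain ⟨W, A, κ, hW, hκ0, hκ, hAsep, hAle⟩ := exists_rows (x := D.x) (y := D.y) hN hε hτ0 hsep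
  have hL := signCount_le hN hSN
  set X := min (N : ℝ) d * τ ^ 2 + 1 with hX
  have hX0 : 0 ≤ X := by
    have : 0 ≤ min (N : ℝ) d := le_min (by positivity) (by positivity)
    positivity
  have hXS : X ≤ 2 * S := by
    have h1 : min (N : ℝ) d * τ ^ 2 ≤ N * 1 := by
      gcongr
      · exact min_le_left _ _
      · nlinarith
    rw [hX]; linarith
  have hW' : (W : ℝ) ≤ 5888 * (1 + Real.log S') ^ 2 * X := by
    calc (W : ℝ) ≤ 23 * (signCount N : ℝ) ^ 2 * X := hW
      _ ≤ 23 * (16 * (1 + Real.log S')) ^ 2 * X := by gcongr; linarith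
      _ = _ := by ring
  have hWS : (W : ℝ) ≤ 11776 * S ^ 3 := by
    have h1 : Real.log S ≤ S - 1 := Real.log_le_sub_one_of_pos (by linarith)
    calc (W : ℝ) ≤ 23 * (signCount N : ℝ) ^ 2 * X := hW
      _ ≤ 23 * (16 * S) ^ 2 * (2 * S) := by gcongr; linarith
      _ = _ := by ring
  -- The radius of the image balls. Replacing `τ` by `σ` at most halves the gap to `1`.
  set σ := max (1 / 2) τ with hσ
  have hσ1 : σ < 1 := max_lt (by norm_num) hρ1
  have hσ0 : 0 ≤ σ := le_trans (by norm_num) (le_max_left _ _)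
  have hσ2 : 1 - τ ≤ 2 * (1 - σ) := by
    rcases le_total (1 / 2) τ with h | h
    · rw [hσ, max_eq_right h]; linarith
    · rw [hσ, max_eq_left h]; linarith
  have hκR : κ * R ≤ 5 * S ^ 3 := by
    -- The lower bound on `ρ` enters: `κ τ ε ≤ σ < 1 < 5 √d τ`.
    have h1 : κ * ε ≤ 5 * √d := by
      have h2 : κ * (τ * ε) ≤ 5 * √d * τ := by linarith
      refine le_of_mul_le_mul_right ?_ hτ0
      linarith
    have h3 : √(d : ℝ) ≤ S := (sqrt_le_self_of_one_le hd1).trans hSd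
    calc κ * R = κ * ε * (R / ε) := by field_simp
      _ ≤ 5 * S * S ^ 2 :=
        mul_le_mul (by linarith) hRε (by positivity) (by linarith)
      _ = _ := by ring
  have hM : κ * R + 1 ≤ S ^ 6 := by
    have h4 : (2 : ℝ) ^ 3 ≤ S ^ 3 := pow_le_pow_left₀ zero_le_two hS2 3
    have h5 : S ^ 3 * S ^ 3 = S ^ 6 := by ring
    have h6 := mul_le_mul_of_nonneg_right h4 (pow_nonneg (by linarith : 0 ≤ S) 3)
    linarith
  obtain ⟨l, hl, hl'⟩ := exists_lt_two_pow (X := S' ^ 32) (one_le_pow₀ (by linarith))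
  rw [Real.log_pow] at hl'
  push_cast at hl'
  have hprec : 4 * (κ * R + 1) ^ 2 * (W / 4 ^ l) ≤ 2 * (1 - σ) :=
    (sq_mul_div_four_pow_le hS2 hSS' h1τ hinv (by positivity) hM (by positivity) hWS hl).trans hσ2
  obtain ⟨net, hnet, hev⟩ := exists_ball_net (x := D.x) (y := D.y) (r := τ * ε) (ρ := σ)
    (M := κ * R + 1) (l := l) A hσ0 hσ1 (by linarith [mul_nonneg hκ0 hR]) hAsep
    (fun i z hz => by
      refine (hAle (z - D.x i)).trans ?_
      calc κ ^ 2 * ∑ t, (z - D.x i) t ^ 2 ≤ κ ^ 2 * (τ * ε) ^ 2 := by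
            gcongr
            simpa using hz
        _ = (κ * (τ * ε)) ^ 2 := by ring
        _ ≤ σ ^ 2 := by gcongr)
    (fun i k => by
      rw [add_sub_cancel_right]
      refine abs_le_of_sq_le_sq ?_ (by positivity)
      calc A k (D.x i) ^ 2 ≤ ∑ k, A k (D.x i) ^ 2 :=
            Finset.single_le_sum (f := fun k => A k (D.x i) ^ 2) (fun _ _ => sq_nonneg _)
              (Finset.mem_univ k)
        _ ≤ κ ^ 2 * ∑ t, D.x i t ^ 2 := hAle _
        _ ≤ κ ^ 2 * R ^ 2 := by gcongr; exact hxR i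
        _ = (κ * R) ^ 2 := by ring)
    hprec
  refine ⟨net, ?_, fun i z hz => hev i z (hball ρ hρ0.le i z hz)⟩
  refine ((Nat.cast_le (α := ℝ)).2 hnet).trans
    (ball_count_le (by linarith) D.dim_pos hN hρ1.le hτ0 ?_ hW' (by linarith))
  have h1 : 1 ≤ (5 * √(d : ℝ) * τ) ^ 2 := one_le_pow₀ hτd.le
  rw [mul_pow, mul_pow, Real.sq_sqrt hd.le] at h1
  linarith

end Dataset

end Main

theorem mainTheorem9 :
    ∃ (K : ℝ) (k : ℕ), ∀ (p : ℝ≥0∞), 1 ≤ p → ∀ (d N C : ℕ) (D : Dataset d N C) (ρ : ℝ),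
      (0 < ρ → ρ ≤ 1 / (5 * N * √(d : ℝ) * gammaP p d) →
        ∃ P : ℕ, (P : ℝ) ≤ K * (√(N : ℝ) + d) * (1 + Real.log (D.scale p)) ^ k ∧
          ∃ f ∈ reluClass d P, D.RobustlyMemorizes p ρ f) ∧
      (1 / (5 * N * √(d : ℝ) * gammaP p d) < ρ → ρ ≤ 1 / (5 * √(d : ℝ) * gammaP p d) →
        ∀ η : ℝ, 0 < η → η < 1 →
        ∃ P : ℕ, (P : ℝ) ≤ K * (N * (d : ℝ) ^ (1 / 4 : ℝ) * ρ ^ (1 / 2 : ℝ)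
              * gammaP p d ^ (1 / 2 : ℝ) + d) * (1 + Real.log (D.scale p)) ^ k ∧
          ∃ f ∈ reluClass d P, D.robustError p ρ f ≤ ENNReal.ofReal η) ∧
      (1 / (5 * √(d : ℝ) * gammaP p d) < ρ → ρ < 1 / gammaP p d →
        ∃ P : ℕ, (P : ℝ) ≤ K * (N * (d : ℝ) ^ 2 * ρ ^ 4 * gammaP p d ^ 4 + d)
              * (1 + Real.log (D.scale p / (1 - ρ * gammaP p d))) ^ k ∧
          ∃ f ∈ reluClass d P, D.RobustlyMemorizes p ρ f) := by
  refine ⟨10 ^ 18, 7, fun p hp d N C D ρ => ?_⟩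
  have hΛ : 1 ≤ 1 + Real.log (D.scale p) := by
    have h1 : (1 : ℝ) ≤ N := by exact_mod_cast (one_le_two.trans D.two_le_card)
    have := Real.log_nonneg (h1.trans (D.le_scale hp).1)
    linarith
  have hγ := gammaP_pos (p := p) D.dim_pos
  refine ⟨fun h0 h1 => ?_, fun h0 h1 η hη _ => ?_, fun h0 h1 => ?_⟩
  · obtain ⟨net, hP, hf⟩ := D.exists_net_of_small hp h0 h1
    refine ⟨net.numParams, hP.trans ?_, net.eval, ⟨net, le_rfl, rfl⟩, hf⟩
    gcongr <;> norm_num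
  · obtain ⟨net, hP, hf⟩ := D.exists_net_of_moderate hp h0 h1 hη
    have hρ : 0 < ρ := lt_of_le_of_lt (by positivity) h0
    refine ⟨net.numParams, hP.trans ?_, net.eval, ⟨net, le_rfl, rfl⟩, hf⟩
    gcongr <;> norm_num
  · obtain ⟨net, hP, hf⟩ := D.exists_net_of_large hp h0 h1
    exact ⟨net.numParams, hP, net.eval, ⟨net, le_rfl, rfl⟩, hf⟩
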